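/- Let $\mathcal S$ denote the complex-valued Schwartz functions on $\mathbb R^3$, let $\widehat\psi(x)=\int_{\mathbb R^3}e^{ix\cdot z}\psi(z)\,dz$, and let $p_t(x)=(2\pi t)^{-3/2}e^{-\|x\|^2/(2t)}$. Fix $\alpha\in(1,2)$ and let $f:\mathbb R^3\to(0,\infty)$ be a locally integrable tempered function whose Fourier transform, in the sense of tempered distributions ($\int f\,\widehat\psi=\int\widehat f\,\psi$ for all $\psi\in\mathcal S$), is a locally integrable tempered function $\widehat f:\mathbb R^3\to(0,\infty)$. Assume that: (i) $f$ is uniformly continuous on $\{\|x\|\ge r\}$ for every $r>0$; (ii) $f(x)=\varphi(\|x\|)$ for all $x\ne0$, where $\varphi$ is nonincreasing on $(0,\infty)$; (iii) $f(x)\asymp\|x\|^{-2}[\log(1/\|x\|)]^{-\alpha}$ uniformly for $0<\|x\|<1/e$; (iv) $\widehat f(z)\asymp\|z\|^{-1}[\log\|z\|]^{-\alpha}$ uniformly for $\|z\|\ge e$. (Here $A\asymp B$ means $C^{-1}B\le A\le CB$ for a constant $C\in(1,\infty)$. The value of $f$ at the single point $0$ is immaterial.) Let $\eta$ be a centered generalized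 Gaussian random field on $\mathbb R_+\times\mathbb R^3$, defined on a probability space $(\Omega,\mathcal F,\mathrm P)$, with covariance $\mathrm{Cov}[\eta(t,x),\eta(s,y)]=\delta_0(t-s)f(x-y)$; that is, $(\eta(\phi))_{\phi\in C_c^\infty(\mathbb R\times\mathbb R^3)}$ is a centered Gaussian process with $$\mathrm{Cov}[\eta(\phi),\eta(\psi)]=\int_0^\infty ds\int_{\mathbb R^3}dy\int_{\mathbb R^3}dy'\,\phi(s,y)\psi(s,y')f(y-y').$$ Let $Z$ be the solution of the linear stochastic heat equation $\partial_tZ=\frac12\Delta Z+\eta$ with $Z(0)\equiv1$, that is, for all $t\ge0$ and $x\in\mathbb R^3$, almost surely, $$Z(t,x)=1+\int_{(0,t)\times\mathbb R^3}p_{t-s}(y-x)\,\eta(ds\,dy).$$ The Wiener integral of $g$ is the $L^2(\mathrm P)$-limit of $\eta(\phi_n)$ for test functions $\phi_n$ that converge to $g$ in the norm $\|g\|^2=(2\pi)^{-3}\int_0^\infty ds\int_{\mathbb R^3}dz\,|\widehat{g(s,\cdot)}(z)|^2\widehat f(z)$. Then, for every $t>0$, $$\mathrm P\Big\{\sup_{x\in\mathcal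 B\cap\mathbb Q^3}Z(t,x)=\infty\ \text{ for every open ball }\mathcal B\subset\mathbb R^3\Big\}=1.$$ Consequently, for every $t>0$, almost surely the function $x\mapsto Z(t,x)$ is unbounded from above in every neighborhood of every point of $\mathbb R^3$. -/

import Mathlib

open MeasureTheory ProbabilityTheory Filter Topology Set
open scoped ENNReal

noncomputable section

namespace LinearSHE

/-- Three-dimensional Euclidean space. -/
abbrev E3 : Type := EuclideanSpace ℝ (Fin 3)

/-- Fourier transform with the normalization `∫ exp(i x·z) g(x) dx`. -/
def fourier (g : E3 → ℂ) (z : E3) : ℂ :=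
  ∫ x : E3, Complex.exp (Complex.I * ((inner ℝ x z : ℝ) : ℂ)) * g x

/-- `fhat` is the Fourier transform of `f` in the sense of tempered distributions: both functions
are locally integrable and tempered, and `⟨f, fourier ψ⟩ = ⟨fhat, ψ⟩` for all Schwartz `ψ`. -/
structure IsFourierTransform (f fhat : E3 → ℝ) : Prop where
  locallyIntegrable : LocallyIntegrable f
  locallyIntegrable_hat : LocallyIntegrable fhat
  tempered : ∀ ψ : SchwartzMap E3 ℂ, Integrable fun x => (f x : ℂ) * ψ x
  tempered_hat : ∀ ψ : SchwartzMap E3 ℂ, Integrable fun z => (fhat z : ℂ) * ψ z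
  pairing : ∀ ψ : SchwartzMap E3 ℂ,
    ∫ x, (f x : ℂ) * fourier (fun z => ψ z) x = ∫ z, (fhat z : ℂ) * ψ z

/-- The class of spatial correlation functions `f` with parameter `α`; `fhat` is the Fourier
transform of `f`. Such an `f` blows up at the origin, so its value at `0` is immaterial, and the
radial profile is only considered on `(0, ∞)`. -/
structure IsCorrelation (α : ℝ) (f fhat : E3 → ℝ) : Prop where
  pos : ∀ x, 0 < f x
  hat_pos : ∀ z, 0 < fhat z
  isFourierTransform : IsFourierTransform f fhat
  uniformContinuousOn : ∀ r : ℝ, 0 < r → UniformContinuousOn f (Metric.ball 0 r)ᶜ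
  radial : ∃ φ : ℝ → ℝ, AntitoneOn φ (Ioi 0) ∧ ∀ x : E3, x ≠ 0 → f x = φ ‖x‖
  near_zero : ∃ C : ℝ, 1 < C ∧ ∀ x : E3, x ≠ 0 → ‖x‖ < Real.exp (-1) →
    C⁻¹ * (‖x‖ ^ (-2 : ℝ) * Real.log (1 / ‖x‖) ^ (-α)) ≤ f x ∧
      f x ≤ C * (‖x‖ ^ (-2 : ℝ) * Real.log (1 / ‖x‖) ^ (-α))
  hat_at_infinity : ∃ C : ℝ, 1 < C ∧ ∀ z : E3, Real.exp 1 ≤ ‖z‖ →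
    C⁻¹ * (‖z‖ ^ (-1 : ℝ) * Real.log ‖z‖ ^ (-α)) ≤ fhat z ∧
      fhat z ≤ C * (‖z‖ ^ (-1 : ℝ) * Real.log ‖z‖ ^ (-α))

/-- Smooth compactly supported space-time test functions. -/
abbrev TestFn : Type := {φ : ℝ × E3 → ℝ // ContDiff ℝ (⊤ : ℕ∞) φ ∧ HasCompactSupport φ}

/-- `η` is a centered generalized Gaussian random field on `ℝ₊ × ℝ³` with
`Cov[η(t,x), η(s,y)] = δ₀(t - s) f(x - y)`: white in time, spatial correlation function `f`. -/
structure IsNoise {Ω : Type*} [MeasurableSpace Ω] (P : Measure Ω) (f : E3 → ℝ)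
    (η : TestFn → Ω → ℝ) : Prop where
  isGaussianProcess : IsGaussianProcess η P
  mean : ∀ φ, ∫ ω, η φ ω ∂P = 0
  cov : ∀ φ ψ, covariance (η φ) (η ψ) P =
    ∫ s in Ioi (0 : ℝ), ∫ y : E3, ∫ y' : E3, φ.1 (s, y) * ψ.1 (s, y') * f (y - y')

/-- The squared norm of the Hilbert space of Wiener integrands, in Fourier variables:
`(2π)⁻³ ∫₀^∞ ds ∫ dz |ĝ(s,z)|² f̂(z)`. By Parseval's identity this is
`∫₀^∞ ds ∫ dy ∫ dy' g(s,y) g(s,y') f(y - y')`, the variance of the integral of `g`. -/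
def integrandNormSq (fhat : E3 → ℝ) (g : ℝ × E3 → ℝ) : ℝ≥0∞ :=
  ENNReal.ofReal ((2 * Real.pi) ^ (-3 : ℝ)) *
    ∫⁻ s in Ioi (0 : ℝ), ∫⁻ z : E3,
      ‖fourier (fun y => (g (s, y) : ℂ)) z‖ₑ ^ 2 * ENNReal.ofReal (fhat z)

/-- `X` is (a version of) the Wiener integral `∫ g(s,y) η(ds dy)` over `(0,∞) × ℝ³`: `X` is the
`L²(P)`-limit of `η φₙ` along test functions `φₙ` that converge to `g` in the Hilbert space of
integrands. -/
def IsWienerIntegral {Ω : Type*} [MeasurableSpace Ω] (P : Measure Ω) (fhat : E3 → ℝ)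
    (η : TestFn → Ω → ℝ) (g : ℝ × E3 → ℝ) (X : Ω → ℝ) : Prop :=
  Measurable g ∧ (∀ s : ℝ, 0 < s → Integrable fun y : E3 => g (s, y)) ∧ MemLp X 2 P ∧
    ∃ φ : ℕ → TestFn,
      Tendsto (fun n => integrandNormSq fhat fun q => (φ n).1 q - g q) atTop (𝓝 0) ∧
      Tendsto (fun n => eLpNorm (fun ω => η (φ n) ω - X ω) 2 P) atTop (𝓝 0)

/-- The heat kernel in `ℝ³` (fundamental solution of `∂ₜ = ½Δ`). -/
def heatKernel (t : ℝ) (x : E3) : ℝ :=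
  (2 * Real.pi * t) ^ (-(3 / 2) : ℝ) * Real.exp (-‖x‖ ^ 2 / (2 * t))

/-- The integrand `(s, y) ↦ p_{t-s}(y - x)` on `(0,t) × ℝ³`, extended by zero. -/
def heatIntegrand (t : ℝ) (x : E3) (q : ℝ × E3) : ℝ :=
  (Ioo 0 t).indicator (fun s => heatKernel (t - s) (q.2 - x)) q.1

/-- `Z` is the mild solution of `∂ₜZ = ½ΔZ + η`, `Z(0) ≡ 1`:
`Z(t,x) = 1 + ∫_{(0,t)×ℝ³} p_{t-s}(y - x) η(ds dy)` almost surely, for each `(t,x)`. -/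
def IsLinearSolution {Ω : Type*} [MeasurableSpace Ω] (P : Measure Ω) (fhat : E3 → ℝ)
    (η : TestFn → Ω → ℝ) (Z : ℝ → E3 → Ω → ℝ) : Prop :=
  ∀ (t : ℝ) (x : E3), 0 ≤ t →
    IsWienerIntegral P fhat η (heatIntegrand t x) fun ω => Z t x ω - 1

/-- The set `ℚ³` in `ℝ³`. -/
def rationalPoints : Set E3 := {x | ∀ i, ∃ q : ℚ, x i = q}

end LinearSHE

end

/-! Fix `t` and a segment of length `ρ`, and look at `Z t - 1` at `2 ^ K` grid points of spacing `δ
= ρ / 2 ^ K`. In Fourier variables the variance of `∑ ξ j * (Z t (x j) - 1)` is, up to a factor `2`,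
the integral of `|∑ ξ j exp(i x j · z)|² exp(-(t - s)‖z‖²) fhat z` over time and frequency. In a box
whose first side is a whole number of periods `2π / δ`, the exponentials are orthogonal, so a box of
side `a` contributes at least a constant times `(log a)^(-α) ∑ ξ j ^ 2`: volume `a³`, `fhat` of
order `a⁻¹ (log a)^(-α)`, time window of order `a⁻²`. Adding `K` dyadic boxes above frequency `2π /
δ`, where `log a` is of order `K`, shows that the covariance matrix dominates `c K^(1-α)` times the
identity (`exists_energy_lower_bound`).

The vector is therefore distributed as `W + G`, with `G` independent of `W` and made of `2 ^ K`
i.i.d. Gaussians of variance `c K^(1-α)`. The maximum of `G` is of order `K^((2-α)/2)`, which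
diverges because `α < 2`. No control of the maximum of `W` is needed: given `W`, the probability
that all coordinates stay below `M` is a product over `j`, and the arithmetic-geometric mean
inequality reduces it to an average of one-coordinate terms, for which Chebyshev suffices
(`measure_forall_lt_le`). Letting `K → ∞` and then the Chebyshev level `L → ∞` shows that `Z t`
exceeds every level on the grids of the segment (`measure_forall_grid_lt`). Countably many rational
segments and levels then give the result. -/

noncomputable section

namespace LinearSHE

open scoped NNReal

/-! ### Gaussian vectors and the lower tail of their maximum. -/

/-- The arithmetic-geometric mean inequality for `n`-fold products in `[0, ∞)`. -/
theorem prod_le_mean_pow {N : ℕ} (hN : 0 < N) (a : Fin N → ℝ≥0) :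
    ∏ j, a j ≤ (N : ℝ≥0)⁻¹ * ∑ j, a j ^ N := by
  have hN' : (N : ℝ≥0) ≠ 0 := by positivity
  have h := NNReal.geom_mean_le_arith_mean_weighted Finset.univ (fun _ => (N : ℝ≥0)⁻¹)
    (fun j => a j ^ N) (by simp [hN'])
  rw [Finset.mul_sum]
  refine le_trans (le_of_eq ?_) h
  refine Finset.prod_congr rfl fun j _ => ?_
  rw [← NNReal.rpow_natCast, ← NNReal.rpow_mul]
  simp [hN.ne']

/-- The covariance matrix of a random vector with centered square integrable coordinates. -/
def secondMoment {Ω : Type*} [MeasurableSpace Ω] (P : Measure Ω) {N : ℕ} (X : Fin N → Ω → ℝ) :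
    Matrix (Fin N) (Fin N) ℝ :=
  Matrix.of fun i j => ∫ ω, X i ω * X j ω ∂P

theorem dotProduct_secondMoment {Ω : Type*} [MeasurableSpace Ω] (P : Measure Ω) {N : ℕ}
    (X : Fin N → Ω → ℝ) (hX : ∀ j, MemLp (X j) 2 P) (ξ : Fin N → ℝ) :
    dotProduct ξ (Matrix.mulVec (secondMoment P X) ξ) = ∫ ω, (∑ j, ξ j * X j ω) ^ 2 ∂P := by
  have hint : ∀ i j, Integrable (fun ω => X i ω * X j ω) P :=
    fun i j => (hX i).integrable_mul (hX j)
  have h1 : ∀ ω, (∑ j, ξ j * X j ω) ^ 2 = ∑ i, ∑ j, ξ i * ξ j * (X i ω * X j ω) := by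
    intro ω
    rw [sq, Finset.sum_mul_sum]
    exact Finset.sum_congr rfl fun i _ => Finset.sum_congr rfl fun j _ => by ring
  simp_rw [h1]
  rw [integral_finsetSum _ fun i _ => integrable_finsetSum _ fun j _ => (hint i j).const_mul _]
  simp only [dotProduct, Matrix.mulVec, secondMoment, Matrix.of_apply]
  refine Finset.sum_congr rfl fun i _ => ?_
  rw [integral_finsetSum _ fun j _ => (hint i j).const_mul _, Finset.mul_sum]
  refine Finset.sum_congr rfl fun j _ => ?_
  rw [integral_const_mul]
  ring

/-- A centered Gaussian vector whose covariance dominates `c • 1` is the sum of a Gaussian vector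
and an independent vector of i.i.d. centered Gaussians of variance `c`. -/
theorem map_eq_conv {Ω : Type*} [MeasurableSpace Ω] (P : Measure Ω)
    [IsProbabilityMeasure P] {N : ℕ} (X : Fin N → Ω → ℝ) (hX : ∀ j, MemLp (X j) 2 P)
    (hchar : ∀ ξ : Fin N → ℝ, ∫ ω, Complex.exp (Complex.I * ((∑ j, ξ j * X j ω : ℝ) : ℂ)) ∂P =
      Complex.exp (-((∫ ω, (∑ j, ξ j * X j ω) ^ 2 ∂P : ℝ) : ℂ) / 2))
    (c : ℝ≥0) (hS : (secondMoment P X - (c : ℝ) • 1).PosSemidef) :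
    P.map (fun ω => WithLp.toLp 2 (fun j => X j ω)) =
      (multivariateGaussian 0 (secondMoment P X - (c : ℝ) • 1)) ∗
        ((Measure.pi fun _ : Fin N => gaussianReal 0 c).map (WithLp.toLp 2)) := by
  have hXm : AEMeasurable (fun ω => WithLp.toLp 2 (fun j => X j ω)) P :=
    (WithLp.measurable_toLp 2 (Fin N → ℝ)).comp_aemeasurable
      (aemeasurable_pi_iff.2 fun j => (hX j).1.aemeasurable)
  have : IsProbabilityMeasure (P.map (fun ω => WithLp.toLp 2 (fun j => X j ω))) :=
    Measure.isProbabilityMeasure_map hXm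
  have : IsProbabilityMeasure
      ((Measure.pi fun _ : Fin N => gaussianReal 0 c).map (WithLp.toLp 2)) :=
    Measure.isProbabilityMeasure_map (WithLp.measurable_toLp 2 (Fin N → ℝ)).aemeasurable
  refine Measure.ext_of_charFun ?_
  ext ξ
  rw [charFun_conv, charFun_multivariateGaussian hS, charFun_pi, charFun_apply,
    integral_map hXm (by fun_prop)]
  have h1 := hchar (fun j => ξ j)
  have h2 : ∀ ω, Complex.exp (((inner ℝ (WithLp.toLp 2 (fun j => X j ω)) ξ : ℝ) : ℂ) * Complex.I)
      = Complex.exp (Complex.I * ((∑ j, ξ j * X j ω : ℝ) : ℂ)) := by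
    intro ω
    rw [mul_comm]
    simp [PiLp.inner_apply, mul_comm]
  simp_rw [h2]
  rw [h1, ← dotProduct_secondMoment P X hX]
  simp only [charFun_gaussianReal]
  rw [← Complex.exp_sum, ← Complex.exp_add]
  -- Both sides are now exponents of Gaussian characteristic functions; they agree because the
  -- quadratic form splits as `(S - c • 1) + c • 1`.
  congr 1
  have h3 : dotProduct (ξ : Fin N → ℝ) (Matrix.mulVec (secondMoment P X - (c : ℝ) • 1) ξ) =
      dotProduct (ξ : Fin N → ℝ) (Matrix.mulVec (secondMoment P X) ξ) - c * ∑ j, ξ j ^ 2 := by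
    rw [Matrix.sub_mulVec, dotProduct_sub, Matrix.smul_mulVec, Matrix.one_mulVec, dotProduct_smul]
    simp [dotProduct, sq]
  rw [h3]
  push_cast
  rw [Finset.mul_sum]
  simp only [inner_zero_right, Complex.ofReal_zero, zero_mul, mul_zero, zero_sub]
  rw [sub_div, Finset.sum_neg_distrib, Finset.sum_div]
  ring

/-- Lower tail of the maximum of a centered Gaussian vector whose covariance dominates `c • 1`. -/
theorem measure_forall_lt_le {Ω : Type*} [MeasurableSpace Ω] (P : Measure Ω)
    [IsProbabilityMeasure P] {N : ℕ} (hN : 0 < N) (X : Fin N → Ω → ℝ) (hX : ∀ j, MemLp (X j) 2 P)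
    (hchar : ∀ ξ : Fin N → ℝ, ∫ ω, Complex.exp (Complex.I * ((∑ j, ξ j * X j ω : ℝ) : ℂ)) ∂P =
      Complex.exp (-((∫ ω, (∑ j, ξ j * X j ω) ^ 2 ∂P : ℝ) : ℂ) / 2))
    (c : ℝ≥0) (V : ℝ)
    (hc : ∀ ξ : Fin N → ℝ, c * ∑ j, ξ j ^ 2 ≤ ∫ ω, (∑ j, ξ j * X j ω) ^ 2 ∂P)
    (hV : ∀ j, ∫ ω, X j ω ^ 2 ∂P ≤ V) (M L : ℝ) (hL : 0 < L) :
    P {ω | ∀ j, X j ω < M} ≤ ENNReal.ofReal (V / L ^ 2) +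
      (gaussianReal 0 c (Iio (M + L))) ^ N := by
  have hq : ∀ ξ : Fin N → ℝ,
      dotProduct ξ (Matrix.mulVec (secondMoment P X - (c : ℝ) • 1) ξ) =
      dotProduct ξ (Matrix.mulVec (secondMoment P X) ξ) - c * ∑ j, ξ j ^ 2 := by
    intro ξ
    rw [Matrix.sub_mulVec, dotProduct_sub, Matrix.smul_mulVec, Matrix.one_mulVec, dotProduct_smul]
    simp [dotProduct, sq]
  have hS : (secondMoment P X - (c : ℝ) • 1).PosSemidef := by
    refine Matrix.PosSemidef.of_dotProduct_mulVec_nonneg ?_ fun ξ => ?_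
    · ext i j
      simp [secondMoment, Matrix.one_apply, mul_comm, eq_comm]
    · have := hc ξ
      rw [star_trivial, hq, dotProduct_secondMoment P X hX]
      linarith
  have hXm : AEMeasurable (fun ω => WithLp.toLp 2 (fun j => X j ω)) P :=
    (WithLp.measurable_toLp 2 (Fin N → ℝ)).comp_aemeasurable
      (aemeasurable_pi_iff.2 fun j => (hX j).1.aemeasurable)
  set S := secondMoment P X - (c : ℝ) • 1 with hSdef
  set γ := gaussianReal 0 c with hγ
  set A : Set (EuclideanSpace ℝ (Fin N)) := {x | ∀ j, x j < M} with hA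
  have hAm : MeasurableSet A := by
    rw [hA, ofPred_forall]
    exact MeasurableSet.iInter fun j => measurableSet_lt (by fun_prop) measurable_const
  -- Condition on the dominated part `w`; independence of the i.i.d. part turns the event into a
  -- product over coordinates.
  have h1 : P {ω | ∀ j, X j ω < M} = ∫⁻ w, ∏ j, γ (Iio (M - w j))
      ∂(multivariateGaussian 0 S) := by
    have : P {ω | ∀ j, X j ω < M} = P.map (fun ω => WithLp.toLp 2 (fun j => X j ω)) A := by
      rw [Measure.map_apply_of_aemeasurable hXm hAm]
      rfl
    rw [this, map_eq_conv P X hX hchar c hS, Measure.conv, Measure.map_apply (by fun_prop) hAm,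
      Measure.prod_apply (measurable_add hAm)]
    refine lintegral_congr fun w => ?_
    rw [Measure.map_apply (by fun_prop) (measurable_prodMk_left (measurable_add hAm)),
      ← Measure.pi_pi]
    congr 1
    ext g
    simp [hA, lt_sub_iff_add_lt']
  -- After the arithmetic-geometric mean inequality each coordinate stands alone: either `|w j| ≥
  -- L`, and the power is at most `1`, or `M - w j ≤ M + L`.
  have hpt : ∀ w : EuclideanSpace ℝ (Fin N), ∏ j, γ (Iio (M - w j)) ≤
      (N : ℝ≥0∞)⁻¹ * ∑ j, ({w : EuclideanSpace ℝ (Fin N) | L ≤ |w j|}.indicator 1 w +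
        (γ (Iio (M + L))) ^ N) := by
    intro w
    have hfin : ∀ j, γ (Iio (M - w j)) = ((γ (Iio (M - w j))).toNNReal : ℝ≥0∞) := fun j =>
      (ENNReal.coe_toNNReal (measure_ne_top _ _)).symm
    have h2 : ∏ j, γ (Iio (M - w j)) ≤ (N : ℝ≥0∞)⁻¹ * ∑ j, γ (Iio (M - w j)) ^ N := by
      have := prod_le_mean_pow hN fun j => (γ (Iio (M - w j))).toNNReal
      have h3 := ENNReal.coe_le_coe.2 this
      rw [ENNReal.coe_mul, ENNReal.coe_inv (by positivity)] at h3
      push_cast at h3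
      simpa only [← hfin] using h3
    refine h2.trans ?_
    gcongr with j
    by_cases hj : L ≤ |w j|
    · rw [indicator_of_mem (by exact hj)]
      refine le_add_right ?_
      exact pow_le_one' prob_le_one N
    · refine le_add_left ?_
      push Not at hj
      gcongr
      have := (abs_lt.1 hj).1
      linarith
  rw [h1]
  refine (lintegral_mono hpt).trans ?_
  have hset : ∀ j, MeasurableSet {w : EuclideanSpace ℝ (Fin N) | L ≤ |w j|} := fun j =>
    measurableSet_le measurable_const (by fun_prop)
  rw [lintegral_const_mul _ (by
      refine Finset.measurable_sum _ fun j _ => ?_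
      exact (measurable_one.indicator (hset j)).add_const _),
    lintegral_finsetSum _ fun j _ => (measurable_one.indicator (hset j)).add_const _]
  have h4 : ∀ j : Fin N, ∫⁻ w, ({w : EuclideanSpace ℝ (Fin N) | L ≤ |w j|}.indicator 1 w +
      (γ (Iio (M + L))) ^ N) ∂(multivariateGaussian 0 S) ≤
      ENNReal.ofReal (V / L ^ 2) + (γ (Iio (M + L))) ^ N := by
    intro j
    rw [lintegral_add_right _ measurable_const, lintegral_indicator_one (hset j), lintegral_const,
      measure_univ, mul_one]
    gcongr
    have hmem : MemLp (fun w : EuclideanSpace ℝ (Fin N) => w j) 2 (multivariateGaussian 0 S) :=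
      (IsGaussian.memLp_dual (multivariateGaussian 0 S)
        (EuclideanSpace.proj j : EuclideanSpace ℝ (Fin N) →L[ℝ] ℝ) 2 (by simp))
    have hmean : ∫ w : EuclideanSpace ℝ (Fin N), w j ∂(multivariateGaussian 0 S) = 0 := by
      have := (EuclideanSpace.proj j : EuclideanSpace ℝ (Fin N) →L[ℝ] ℝ).integral_comp_id_comm
        (μ := multivariateGaussian 0 S) IsGaussian.integrable_id
      rw [integral_id_multivariateGaussian, map_zero] at this
      exact this
    -- Chebyshev; the variance of `w j` is that of `X j` minus `c`, hence at most `V`.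
    have := meas_ge_le_variance_div_sq hmem hL
    simp only [hmean, sub_zero] at this
    refine this.trans ?_
    gcongr
    rw [variance_eval_multivariateGaussian hS]
    have h6 := hV j
    simp only [hSdef, secondMoment, Matrix.sub_apply, Matrix.of_apply, Matrix.smul_apply,
      Matrix.one_apply_eq, smul_eq_mul, mul_one]
    simp_rw [← sq]
    have : (0 : ℝ) ≤ c := c.2
    linarith
  calc (N : ℝ≥0∞)⁻¹ * ∑ j : Fin N, ∫⁻ w, ({w : EuclideanSpace ℝ (Fin N) | L ≤ |w j|}.indicator 1 w +
      (γ (Iio (M + L))) ^ N) ∂(multivariateGaussian 0 S)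
      ≤ (N : ℝ≥0∞)⁻¹ * ∑ j : Fin N, (ENNReal.ofReal (V / L ^ 2) + (γ (Iio (M + L))) ^ N) := by
        gcongr with j
        exact h4 j
    _ = _ := by
        rw [Finset.sum_const, Finset.card_univ, Fintype.card_fin, nsmul_eq_mul, ← mul_assoc,
          ENNReal.inv_mul_cancel (by simpa using hN.ne') (by simp), one_mul]

/-- A lower bound for the upper tail of a centered Gaussian of variance at most `1`. -/
theorem gaussianReal_Iio_le (c : ℝ≥0) (hc0 : 0 < c) (hc : c ≤ 1) (u : ℝ) (hu : 0 ≤ u) :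
    gaussianReal 0 c (Iio u) ≤ ENNReal.ofReal (1 - Real.exp (-(u + 1) ^ 2 / (2 * c)) / 3) := by
  have hsum : gaussianReal 0 c (Iio u) = 1 - gaussianReal 0 c (Ici u) := by
    rw [← compl_Ici, prob_compl_eq_one_sub measurableSet_Ici]
  have hge : ENNReal.ofReal (Real.exp (-(u + 1) ^ 2 / (2 * c)) / 3) ≤
      gaussianReal 0 c (Ici u) := by
    rw [gaussianReal_apply _ hc0.ne']
    calc ENNReal.ofReal (Real.exp (-(u + 1) ^ 2 / (2 * c)) / 3)
        = ∫⁻ _ in Icc u (u + 1), ENNReal.ofReal (Real.exp (-(u + 1) ^ 2 / (2 * c)) / 3) := by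
          simp
      _ ≤ ∫⁻ x in Icc u (u + 1), gaussianPDF 0 c x := by
          refine setLIntegral_mono (by fun_prop) fun x hx => ?_
          rw [gaussianPDF, gaussianPDFReal]
          refine ENNReal.ofReal_le_ofReal ?_
          have hc' : (0 : ℝ) < c := hc0
          have hc1 : (c : ℝ) ≤ 1 := hc
          rw [div_eq_inv_mul, sub_zero]
          gcongr
          -- The constant `1 / 3`: the density is bounded below on an interval of length one, and
          -- `√(2πc) ≤ 3` since `c ≤ 1` and `2π < 9`.
          · rw [Real.sqrt_le_left (by norm_num)]
            nlinarith [Real.pi_lt_four, Real.pi_pos]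
          · linarith [hx.1]
          · exact hx.2
      _ ≤ _ := lintegral_mono_set Icc_subset_Ici_self
  rw [hsum, ENNReal.ofReal_sub _ (by positivity), ENNReal.ofReal_one]
  gcongr

/-- One factor is at most `1 - p ≤ exp (-p)` with `p = exp (-A K^(α-1)) / 3`, so the power is at
most `exp (-2 ^ K p)`. Since `α - 1 < 1`, the exponential growth of `2 ^ K` beats the decay of `p`.
This is where `α < 2` enters. -/
theorem tendsto_gaussianReal_Iio_pow (α : ℝ) (hα₁ : 1 < α) (hα₂ : α < 2) (c₀ : ℝ≥0)
    (hc₀ : 0 < c₀) (u : ℝ) :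
    Tendsto (fun K : ℕ => (gaussianReal 0 (c₀ * (K : ℝ≥0) ^ (1 - α)) (Iio u)) ^ (2 ^ K))
      atTop (𝓝 0) := by
  wlog hu : 0 ≤ u generalizing u
  · refine tendsto_of_tendsto_of_tendsto_of_le_of_le tendsto_const_nhds (this 0 le_rfl)
      (fun _ => zero_le) fun K => ?_
    dsimp only
    gcongr
    linarith
  have hlim : Tendsto (fun K : ℕ => c₀ * (K : ℝ≥0) ^ (1 - α)) atTop (𝓝 0) := by
    have h1 : Tendsto (fun K : ℕ => (K : ℝ≥0) ^ (1 - α)) atTop (𝓝 0) := by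
      rw [← NNReal.tendsto_coe]
      have := (tendsto_rpow_neg_atTop (y := α - 1) (by linarith)).comp
        (tendsto_natCast_atTop_atTop (R := ℝ))
      simpa [Function.comp_def] using this
    simpa using h1.const_mul c₀
  set A : ℝ := (u + 1) ^ 2 / (2 * c₀) with hA
  have hbig : Tendsto (fun K : ℕ => (K : ℝ) * Real.log 2 - A * (K : ℝ) ^ (α - 1)) atTop atTop := by
    have h1 : Tendsto (fun x : ℝ => x * (Real.log 2 - A * x ^ (α - 2))) atTop atTop := by
      refine Tendsto.atTop_mul_pos (C := Real.log 2) (Real.log_pos (by norm_num)) tendsto_id ?_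
      have := (tendsto_rpow_neg_atTop (y := 2 - α) (by linarith)).const_mul A
      simpa using tendsto_const_nhds.sub this
    have h2 := h1.comp (tendsto_natCast_atTop_atTop (R := ℝ))
    refine h2.congr' ?_
    filter_upwards [eventually_gt_atTop 0] with K hK
    have hK' : (0 : ℝ) < K := by exact_mod_cast hK
    simp only [Function.comp]
    rw [show α - 1 = (α - 2) + 1 by ring, Real.rpow_add_one hK'.ne']
    ring
  have hexp : Tendsto (fun K : ℕ => ENNReal.ofReal
      (Real.exp (-(Real.exp ((K : ℝ) * Real.log 2 - A * (K : ℝ) ^ (α - 1)) / 3)))) atTop (𝓝 0) := by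
    rw [← ENNReal.ofReal_zero]
    refine ENNReal.tendsto_ofReal ?_
    refine Real.tendsto_exp_neg_atTop_nhds_zero.comp ?_
    exact (Real.tendsto_exp_atTop.comp hbig).atTop_div_const (by norm_num)
  refine tendsto_of_tendsto_of_tendsto_of_le_of_le' tendsto_const_nhds hexp
    (Eventually.of_forall fun _ => zero_le) ?_
  filter_upwards [hlim.eventually_le_const one_pos, eventually_gt_atTop 0] with K hK hK0
  have hK' : (0 : ℝ) < K := by exact_mod_cast hK0
  have hcK : 0 < c₀ * (K : ℝ≥0) ^ (1 - α) := by
    have : (0 : ℝ≥0) < K := by exact_mod_cast hK0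
    positivity
  have h1 := gaussianReal_Iio_le _ hcK hK u hu
  have hE : -(u + 1) ^ 2 / (2 * ((c₀ * (K : ℝ≥0) ^ (1 - α) : ℝ≥0) : ℝ)) =
      -(A * (K : ℝ) ^ (α - 1)) := by
    have : (K : ℝ) ^ (α - 1) = ((K : ℝ) ^ (1 - α))⁻¹ := by
      rw [← Real.rpow_neg hK'.le]; congr 1; ring
    rw [this, hA]
    push_cast
    have h0 : (0 : ℝ) < (K : ℝ) ^ (1 - α) := by positivity
    have h0' : (0 : ℝ) < c₀ := hc₀
    field_simp
  rw [hE] at h1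
  set p := Real.exp (-(A * (K : ℝ) ^ (α - 1))) / 3 with hp
  calc (gaussianReal 0 (c₀ * (K : ℝ≥0) ^ (1 - α)) (Iio u)) ^ (2 ^ K)
      ≤ (ENNReal.ofReal (Real.exp (-p))) ^ (2 ^ K) := by
        gcongr
        refine h1.trans (ENNReal.ofReal_le_ofReal ?_)
        linarith [Real.add_one_le_exp (-p)]
    _ = ENNReal.ofReal (Real.exp (-((2 : ℝ) ^ K * p))) := by
        rw [← ENNReal.ofReal_pow (Real.exp_pos _).le, ← Real.exp_nat_mul]
        push_cast
        ring_nf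
    _ = _ := by
        have : Real.exp ((K : ℝ) * Real.log 2 - A * (K : ℝ) ^ (α - 1)) =
            (2 : ℝ) ^ K * Real.exp (-(A * (K : ℝ) ^ (α - 1))) := by
          rw [sub_eq_add_neg, Real.exp_add, mul_comm (K : ℝ), Real.exp_mul, Real.exp_log two_pos,
            Real.rpow_natCast]
        rw [this, hp, mul_div_assoc]

/-! ### The covariance form of test functions and Parseval's identity. -/

/-- Uniform bounds for a continuous compactly supported space-time function. -/
theorem exists_bound_support {Φ : ℝ × E3 → ℝ} (hΦ : Continuous Φ) (hs : HasCompactSupport Φ) :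
    ∃ A R : ℝ, ∀ q, ‖Φ q‖ ≤ A ∧ (Φ q ≠ 0 → ‖q.1‖ ≤ R ∧ ‖q.2‖ ≤ R) := by
  obtain ⟨A, hA⟩ := hs.exists_bound_of_continuous hΦ
  obtain ⟨R, hR⟩ := hs.isCompact.isBounded.exists_norm_le
  refine ⟨A, R, fun q => ⟨hA q, fun hq => ?_⟩⟩
  have := hR q (subset_tsupport _ hq)
  exact ⟨(norm_fst_le q).trans this, (norm_snd_le q).trans this⟩

/-- The covariance integrand of the noise is integrable. -/
theorem integrable_covKernel {f : E3 → ℝ} (hf : LocallyIntegrable f) {Φ Ψ : ℝ × E3 → ℝ}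
    (hΦ : Continuous Φ) (hΦs : HasCompactSupport Φ) (hΨ : Continuous Ψ)
    (hΨs : HasCompactSupport Ψ) :
    Integrable (fun p : ℝ × E3 × E3 => Φ (p.1, p.2.1) * Ψ (p.1, p.2.2) * f (p.2.1 - p.2.2))
      ((volume.restrict (Ioi (0 : ℝ))).prod
        ((volume : Measure E3).prod (volume : Measure E3))) := by
  obtain ⟨A, R, hA⟩ := exists_bound_support hΦ hΦs
  obtain ⟨B, S, hB⟩ := exists_bound_support hΨ hΨs
  have h1 : Integrable ((Metric.closedBall (0 : E3) S).indicator fun _ => (1 : ℝ)) :=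
    (integrable_indicator_iff measurableSet_closedBall).2
      (integrableOn_const (measure_closedBall_lt_top.ne))
  have h2 : Integrable ((Metric.closedBall (0 : E3) (R + S)).indicator f) :=
    (integrable_indicator_iff measurableSet_closedBall).2
      (hf.integrableOn_isCompact (isCompact_closedBall _ _))
  have h3 : Integrable ((Metric.closedBall (0 : ℝ) R).indicator fun _ => (1 : ℝ))
      (volume.restrict (Ioi (0 : ℝ))) :=
    ((integrable_indicator_iff measurableSet_closedBall).2
      (integrableOn_const (measure_closedBall_lt_top.ne))).restrict
  -- On the supports `‖y - y'‖ ≤ R + S`, so `f` may be cut off to a ball and becomes integrable; `Φ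
  -- Ψ` is then a bounded factor.
  have h4 := Integrable.convolution_integrand (ContinuousLinearMap.mul ℝ ℝ) h1 h2
  have h5 := (h3.mul_prod h4).bdd_mul (c := A * B)
    (f := fun p : ℝ × E3 × E3 => Φ (p.1, p.2.1) * Ψ (p.1, p.2.2))
    (by fun_prop) (ae_of_all _ fun p => by
      rw [norm_mul]
      exact mul_le_mul (hA _).1 (hB _).1 (norm_nonneg _) ((norm_nonneg _).trans (hA (0, 0)).1))
  refine h5.congr (ae_of_all _ fun p => ?_)
  obtain ⟨s, y, y'⟩ := p
  simp only [ContinuousLinearMap.mul_apply']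
  by_cases hy : Φ (s, y) = 0
  · simp [hy]
  by_cases hy' : Ψ (s, y') = 0
  · simp [hy']
  have e1 := (hA (s, y)).2 hy
  have e2 := (hB (s, y')).2 hy'
  rw [indicator_of_mem (by simpa using e1.1), indicator_of_mem (by simpa using e2.2),
    indicator_of_mem]
  · ring
  · simp only [Metric.mem_closedBall, dist_zero_right]
    exact (norm_sub_le _ _).trans (add_le_add e1.2 e2.2)

theorem integral_covKernel {f : E3 → ℝ} (hf : LocallyIntegrable f) {Φ Ψ : ℝ × E3 → ℝ}
    (hΦ : Continuous Φ) (hΦs : HasCompactSupport Φ) (hΨ : Continuous Ψ)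
    (hΨs : HasCompactSupport Ψ) :
    ∫ p, Φ (p.1, p.2.1) * Ψ (p.1, p.2.2) * f (p.2.1 - p.2.2)
      ∂((volume.restrict (Ioi (0 : ℝ))).prod ((volume : Measure E3).prod (volume : Measure E3))) =
    ∫ s in Ioi (0 : ℝ), ∫ y : E3, ∫ y' : E3, Φ (s, y) * Ψ (s, y') * f (y - y') := by
  have h := integrable_covKernel hf hΦ hΦs hΨ hΨs
  rw [integral_prod _ h]
  refine integral_congr_ae ?_
  filter_upwards [h.prod_right_ae] with s hs
  rw [integral_prod _ hs]

/-- Autocorrelation of a Schwartz function, as a Schwartz function. -/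
def autocorr (u : SchwartzMap E3 ℂ) : SchwartzMap E3 ℂ :=
  SchwartzMap.convolution (ContinuousLinearMap.mul ℂ ℂ) u
    (SchwartzMap.compCLMOfContinuousLinearEquiv ℂ (ContinuousLinearEquiv.neg ℝ) u)

theorem autocorr_apply (u : SchwartzMap E3 ℂ) (h : E3) :
    autocorr u h = ∫ y, u y * u (y - h) := by
  rw [autocorr, SchwartzMap.convolution_apply]
  simp [MeasureTheory.convolution]

open FourierTransform in
-- For real `u`, the transforms of `u` and of its reflection are complex conjugates, so their
-- product is a squared modulus. The dilation by `2π` passes from the kernel `exp(-2πi x·w)` of `𝓕`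
-- to that of `fourier`.
theorem fourier_autocorr (u : SchwartzMap E3 ℂ) (hu : ∀ y, (starRingEnd ℂ) (u y) = u y) (w : E3) :
    𝓕 (autocorr u) w = ((‖fourier u ((2 * Real.pi) • w)‖ ^ 2 : ℝ) : ℂ) := by
  have e1 : 𝓕 (u : E3 → ℂ) w = (starRingEnd ℂ) (fourier u ((2 * Real.pi) • w)) := by
    rw [Real.fourier_eq', fourier, ← integral_conj]
    refine integral_congr_ae (ae_of_all _ fun y => ?_)
    simp only [map_mul, hu, ← Complex.exp_conj, Complex.conj_I, Complex.conj_ofReal, smul_eq_mul,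
      inner_smul_right]
    congr 2
    push_cast
    ring
  have e2 : 𝓕 (fun y => u (-y)) w = fourier u ((2 * Real.pi) • w) := by
    rw [Real.fourier_eq', fourier, ← integral_neg_eq_self]
    refine integral_congr_ae (ae_of_all _ fun y => ?_)
    simp only [smul_eq_mul, inner_smul_right, neg_neg, inner_neg_left]
    congr 2
    push_cast
    ring
  rw [autocorr, SchwartzMap.fourier_convolution_apply, Real.fourier_bilin_convolution_eq]
  · have e3 : ((SchwartzMap.compCLMOfContinuousLinearEquiv ℂ (ContinuousLinearEquiv.neg ℝ) u :
      SchwartzMap E3 ℂ) : E3 → ℂ) = fun y => u (-y) := by ext y; simp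
    rw [e3, e1, e2, ContinuousLinearMap.mul_apply', ← Complex.normSq_eq_conj_mul_self,
      Complex.normSq_eq_norm_sq]
  · exact u.integrable
  · exact SchwartzMap.integrable _

open FourierTransform in
/-- The spectral test function `(2π)⁻³ |û|²`, as a Schwartz function. -/
def spectral (u : SchwartzMap E3 ℂ) : SchwartzMap E3 ℂ :=
  (((2 * Real.pi) ^ (-3 : ℝ) : ℝ) : ℂ) • SchwartzMap.compCLMOfContinuousLinearEquiv ℂ
    (ContinuousLinearEquiv.smulLeft (Units.mk0 ((2 * Real.pi)⁻¹ : ℝ) (by positivity)))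
    (𝓕 (autocorr u))

theorem spectral_apply (u : SchwartzMap E3 ℂ) (hu : ∀ y, (starRingEnd ℂ) (u y) = u y) (z : E3) :
    spectral u z = (((2 * Real.pi) ^ (-3 : ℝ) * ‖fourier u z‖ ^ 2 : ℝ) : ℂ) := by
  have : (2 * Real.pi) • ((2 * Real.pi)⁻¹ • z) = z := by
    rw [smul_smul, mul_inv_cancel₀ (by positivity), one_smul]
  simp only [spectral, smul_apply, SchwartzMap.compCLMOfContinuousLinearEquiv_apply,
    Function.comp, ContinuousLinearEquiv.smulLeft_apply_apply, Units.smul_mk0, smul_eq_mul]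
  rw [fourier_autocorr u hu, this]
  push_cast
  ring

open FourierTransform in
-- Fourier inversion: the dilation contributes the Jacobian `(2π)³`, cancelled by the `(2π)⁻³` in
-- `spectral`. Thus `spectral u` is the test function to insert in the distributional pairing.
theorem fourier_spectral (u : SchwartzMap E3 ℂ) (x : E3) :
    fourier (fun z => spectral u z) x = autocorr u x := by
  have e1 : autocorr u x = 𝓕 ((𝓕 (autocorr u) : SchwartzMap E3 ℂ) : E3 → ℂ) (-x) := by
    rw [← Real.fourierInv_eq_fourier_neg, ← SchwartzMap.fourierInv_coe]
    simp
  have hpi : (0 : ℝ) < (2 * Real.pi)⁻¹ := by positivity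
  rw [e1, Real.fourier_eq', fourier]
  have e2 := Measure.integral_comp_smul (volume : Measure E3)
    (fun w : E3 => Complex.exp ((↑(-2 * Real.pi * inner ℝ w (-x)) * Complex.I)) •
      (𝓕 (autocorr u) : SchwartzMap E3 ℂ) w) ((2 * Real.pi)⁻¹)
  have e3 : |(((2 * Real.pi)⁻¹ : ℝ) ^ Module.finrank ℝ E3)⁻¹| = (2 * Real.pi) ^ 3 := by
    rw [finrank_euclideanSpace_fin, inv_pow, inv_inv, abs_of_pos (by positivity)]
  rw [e3] at e2
  have e4 : ∀ z : E3, Complex.exp (Complex.I * ((inner ℝ z x : ℝ) : ℂ)) * spectral u z =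
      (((2 * Real.pi) ^ (-3 : ℝ) : ℝ) : ℂ) *
      (Complex.exp ((↑(-2 * Real.pi * inner ℝ ((2 * Real.pi)⁻¹ • z) (-x)) * Complex.I)) •
      (𝓕 (autocorr u) : SchwartzMap E3 ℂ) ((2 * Real.pi)⁻¹ • z)) := by
    intro z
    have : -2 * Real.pi * inner ℝ ((2 * Real.pi)⁻¹ • z) (-x) = inner ℝ z x := by
      rw [inner_smul_left, inner_neg_right]
      simp only [RCLike.conj_to_real]
      field_simp
    rw [this]
    simp only [spectral, smul_apply, SchwartzMap.compCLMOfContinuousLinearEquiv_apply,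
      Function.comp, ContinuousLinearEquiv.smulLeft_apply_apply, Units.smul_mk0, smul_eq_mul]
    rw [mul_comm Complex.I]
    ring
  simp_rw [e4]
  rw [integral_const_mul, e2, Complex.real_smul, ← mul_assoc, ← Complex.ofReal_mul]
  have : (2 * Real.pi) ^ (-3 : ℝ) * (2 * Real.pi) ^ 3 = 1 := by
    rw [← Real.rpow_natCast, ← Real.rpow_add (by positivity)]
    norm_num
  rw [this, Complex.ofReal_one, one_mul]

/-- Parseval's identity for the spatial covariance form of a smooth compactly supported function. -/
theorem parseval {f fhat : E3 → ℝ} (h : IsFourierTransform f fhat) {u : E3 → ℝ}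
    (hu : ContDiff ℝ (⊤ : ℕ∞) u) (hs : HasCompactSupport u) :
    Integrable (fun z => ‖fourier (fun y => (u y : ℂ)) z‖ ^ 2 * fhat z) ∧
    ∫ y, ∫ y', u y * u y' * f (y - y') =
      (2 * Real.pi) ^ (-3 : ℝ) * ∫ z, ‖fourier (fun y => (u y : ℂ)) z‖ ^ 2 * fhat z := by
  have hsU : HasCompactSupport (fun y => (u y : ℂ)) := hs.comp_left (g := fun x : ℝ => (x : ℂ)) rfl
  set U : SchwartzMap E3 ℂ := hsU.toSchwartzMap (Complex.ofRealCLM.contDiff.comp hu) with hU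
  have hUc : (U : E3 → ℂ) = fun y => (u y : ℂ) := rfl
  have hUr : ∀ y, (starRingEnd ℂ) (U y) = U y := fun y => by rw [hUc]; exact Complex.conj_ofReal _
  have hpi : (0 : ℝ) < (2 * Real.pi) ^ (-3 : ℝ) := by positivity
  have hspec : ∀ z, (fhat z : ℂ) * spectral U z =
      (((2 * Real.pi) ^ (-3 : ℝ) * (‖fourier (fun y => (u y : ℂ)) z‖ ^ 2 * fhat z) : ℝ) : ℂ) := by
    intro z
    rw [spectral_apply U hUr, hUc]
    push_cast
    ring
  have hint : Integrable fun z =>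
      (2 * Real.pi) ^ (-3 : ℝ) * (‖fourier (fun y => (u y : ℂ)) z‖ ^ 2 * fhat z) := by
    have := (h.tempered_hat (spectral U)).re
    refine this.congr (ae_of_all _ fun z => ?_)
    simp only [hspec, RCLike.re_to_complex, Complex.ofReal_re]
  refine ⟨(integrable_const_mul_iff (isUnit_iff_ne_zero.2 hpi.ne') _).1 hint, ?_⟩
  have hpair := h.pairing (spectral U)
  simp_rw [fourier_spectral, hspec] at hpair
  rw [integral_complex_ofReal, integral_const_mul] at hpair
  rw [← Complex.ofReal_inj, ← hpair]
  have hcorr : ∀ x, (f x : ℂ) * autocorr U x = ((∫ y, u y * u (y - x) * f x : ℝ) : ℂ) := by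
    intro x
    rw [autocorr_apply, integral_mul_const, Complex.ofReal_mul, mul_comm, ← integral_complex_ofReal]
    simp [hUc]
  simp_rw [hcorr]
  rw [integral_complex_ofReal, Complex.ofReal_inj]
  -- Substitute `x = y - y'`; Fubini then matches the double integral with the pairing of `f` and
  -- the autocorrelation.
  have hsub : ∀ y, ∫ y', u y * u y' * f (y - y') = ∫ x, u y * u (y - x) * f x := by
    intro y
    rw [← integral_sub_left_eq_self _ volume y]
    simp
  simp_rw [hsub]
  refine integral_integral_swap ?_
  obtain ⟨A, hA⟩ := hs.exists_bound_of_continuous hu.continuous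
  obtain ⟨R, hR⟩ := hs.isCompact.isBounded.exists_norm_le
  have hR' : ∀ y, u y ≠ 0 → ‖y‖ ≤ R := fun y hy => hR y (subset_tsupport _ hy)
  have h1 : Integrable ((Metric.closedBall (0 : E3) R).indicator fun _ => (1 : ℝ)) :=
    (integrable_indicator_iff measurableSet_closedBall).2
      (integrableOn_const (measure_closedBall_lt_top.ne))
  have h2 : Integrable ((Metric.closedBall (0 : E3) (R + R)).indicator f) :=
    (integrable_indicator_iff measurableSet_closedBall).2
      (h.locallyIntegrable.integrableOn_isCompact (isCompact_closedBall _ _))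
  have huc := hu.continuous
  have h5 := (h1.mul_prod h2).bdd_mul (c := A * A)
    (f := fun p : E3 × E3 => u p.1 * u (p.1 - p.2))
    (by fun_prop) (ae_of_all _ fun p => by
      rw [norm_mul]
      exact mul_le_mul (hA _) (hA _) (norm_nonneg _) ((norm_nonneg _).trans (hA 0)))
  refine h5.congr (ae_of_all _ fun p => ?_)
  obtain ⟨y, x⟩ := p
  simp only [Function.uncurry]
  by_cases hy : u y = 0
  · simp [hy]
  by_cases hy' : u (y - x) = 0
  · simp [hy']
  rw [indicator_of_mem (by simpa using hR' y hy), indicator_of_mem]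
  · ring
  · simp only [Metric.mem_closedBall, dist_zero_right]
    have := norm_sub_le y (y - x)
    rw [sub_sub_cancel] at this
    linarith [hR' y hy, hR' _ hy']

/-- The covariance form of the noise on a test function is its squared norm as an integrand. -/
theorem integrandNormSq_eq {f fhat : E3 → ℝ} (h : IsFourierTransform f fhat)
    (hpos : ∀ z, 0 < fhat z) {Φ : ℝ × E3 → ℝ}
    (hΦ : ContDiff ℝ (⊤ : ℕ∞) Φ) (hs : HasCompactSupport Φ) :
    integrandNormSq fhat Φ = ENNReal.ofReal
      (∫ s in Ioi (0 : ℝ), ∫ y : E3, ∫ y' : E3, Φ (s, y) * Φ (s, y') * f (y - y')) := by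
  have hK := integrable_covKernel h.locallyIntegrable hΦ.continuous hs hΦ.continuous hs
  have hslice : ∀ s : ℝ, ContDiff ℝ (⊤ : ℕ∞) (fun y => Φ (s, y)) ∧
      HasCompactSupport fun y => Φ (s, y) := by
    intro s
    refine ⟨hΦ.comp (contDiff_prodMk_right s), ?_⟩
    obtain ⟨A, R, hA⟩ := exists_bound_support hΦ.continuous hs
    refine HasCompactSupport.of_support_subset_isCompact (isCompact_closedBall (0 : E3) R) ?_
    intro y hy
    simpa using ((hA (s, y)).2 hy).2
  have hval : ∀ s : ℝ, ENNReal.ofReal (∫ y : E3, ∫ y' : E3, Φ (s, y) * Φ (s, y') * f (y - y')) =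
      ENNReal.ofReal ((2 * Real.pi) ^ (-3 : ℝ)) *
      ∫⁻ z : E3, ‖fourier (fun y => (Φ (s, y) : ℂ)) z‖ₑ ^ 2 * ENNReal.ofReal (fhat z) := by
    intro s
    obtain ⟨h1, h2⟩ := parseval h (hslice s).1 (hslice s).2
    rw [h2, ENNReal.ofReal_mul (by positivity), ofReal_integral_eq_lintegral_ofReal h1
      (ae_of_all _ fun z => mul_nonneg (by positivity) (hpos z).le)]
    congr 1
    refine lintegral_congr fun z => ?_
    rw [ENNReal.ofReal_mul (by positivity), ENNReal.ofReal_pow (norm_nonneg _), ofReal_norm]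
  have hint : Integrable (fun s => ∫ y : E3, ∫ y' : E3, Φ (s, y) * Φ (s, y') * f (y - y'))
      (volume.restrict (Ioi (0 : ℝ))) := by
    refine hK.integral_prod_left.congr ?_
    filter_upwards [hK.prod_right_ae] with s hs
    rw [integral_prod _ hs]
  rw [ofReal_integral_eq_lintegral_ofReal hint, lintegral_congr hval, lintegral_const_mul',
    integrandNormSq]
  · exact ENNReal.ofReal_ne_top
  -- Parseval makes each slice of the covariance nonnegative, as the passage to a lower integral
  -- requires.
  · refine ae_of_all _ fun s => ?_
    obtain ⟨h1, h2⟩ := parseval h (hslice s).1 (hslice s).2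
    simp only [h2]
    exact mul_nonneg (by positivity)
      (integral_nonneg fun z => mul_nonneg (by positivity) (hpos z).le)

/-! ### The squared norm of integrands. -/

theorem integrable_fourier_integrand {g : E3 → ℂ} (hg : Integrable g) (z : E3) :
    Integrable fun x : E3 => Complex.exp (Complex.I * ((inner ℝ x z : ℝ) : ℂ)) * g x :=
  hg.bdd_mul (c := 1) (by fun_prop) (ae_of_all _ fun x => by
    rw [mul_comm, Complex.norm_exp_ofReal_mul_I])

theorem fourier_add_smul {g h : E3 → ℝ} (hg : Integrable g) (hh : Integrable h) (a : ℝ) (z : E3) :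
    fourier (fun x => ((g x + a * h x : ℝ) : ℂ)) z =
      fourier (fun x => (g x : ℂ)) z + a * fourier (fun x => (h x : ℂ)) z := by
  simp only [fourier]
  have hg' : Integrable fun x => (g x : ℂ) := hg.ofReal
  have hh' : Integrable fun x => (h x : ℂ) := hh.ofReal
  rw [← integral_const_mul, ← integral_add (integrable_fourier_integrand hg' z)
    ((integrable_fourier_integrand hh' z).const_mul _)]
  refine integral_congr_ae (ae_of_all _ fun x => ?_)
  dsimp only
  push_cast
  ring

theorem fourier_const_mul (h : E3 → ℝ) (a : ℝ) (z : E3) :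
    fourier (fun x => ((a * h x : ℝ) : ℂ)) z = a * fourier (fun x => (h x : ℂ)) z := by
  simp only [fourier]
  rw [← integral_const_mul]
  refine integral_congr_ae (ae_of_all _ fun x => ?_)
  dsimp only
  push_cast
  ring

theorem measurable_fourier {g : ℝ × E3 → ℝ} (hg : Measurable g) :
    Measurable fun p : ℝ × E3 => fourier (fun y => (g (p.1, y) : ℂ)) p.2 := by
  have : Measurable fun q : (ℝ × E3) × E3 =>
      Complex.exp (Complex.I * ((inner ℝ q.2 q.1.2 : ℝ) : ℂ)) * (g (q.1.1, q.2) : ℂ) := by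
    fun_prop
  exact (this.stronglyMeasurable.integral_prod_right (ν := (volume : Measure E3))).measurable

theorem integrandNormSq_const_mul (fhat : E3 → ℝ) (g : ℝ × E3 → ℝ) (a : ℝ) :
    integrandNormSq fhat (fun q => a * g q) = ENNReal.ofReal (a ^ 2) * integrandNormSq fhat g := by
  simp only [integrandNormSq, fourier_const_mul]
  rw [mul_left_comm]
  congr 1
  rw [← lintegral_const_mul' _ _ ENNReal.ofReal_ne_top]
  refine lintegral_congr fun s => ?_
  rw [← lintegral_const_mul' _ _ ENNReal.ofReal_ne_top]
  refine lintegral_congr fun z => ?_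
  rw [enorm_mul, mul_pow, ← mul_assoc, ← sq_abs a, ENNReal.ofReal_pow (abs_nonneg a)]
  congr 3
  rw [← ofReal_norm, Complex.norm_real, Real.norm_eq_abs]

theorem enorm_add_sq_le (a b : ℂ) : ‖a + b‖ₑ ^ 2 ≤ 2 * ‖a‖ₑ ^ 2 + 2 * ‖b‖ₑ ^ 2 := by
  have h : ‖a + b‖ ^ 2 ≤ 2 * ‖a‖ ^ 2 + 2 * ‖b‖ ^ 2 := by
    have := norm_add_le a b
    nlinarith [sq_nonneg (‖a‖ - ‖b‖), norm_nonneg (a + b), norm_nonneg a, norm_nonneg b]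
  have := ENNReal.ofReal_le_ofReal h
  rw [ENNReal.ofReal_add (by positivity) (by positivity), ENNReal.ofReal_mul two_pos.le,
    ENNReal.ofReal_mul two_pos.le, ENNReal.ofReal_pow (norm_nonneg _),
    ENNReal.ofReal_pow (norm_nonneg _), ENNReal.ofReal_pow (norm_nonneg _)] at this
  simpa only [ofReal_norm, ENNReal.ofReal_ofNat] using this

/-- Measurable space-time functions all of whose time slices are integrable. -/
def SliceIntegrable (g : ℝ × E3 → ℝ) : Prop :=
  Measurable g ∧ ∀ s : ℝ, 0 < s → Integrable fun y : E3 => g (s, y)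

theorem SliceIntegrable.add_smul {g h : ℝ × E3 → ℝ} (hg : SliceIntegrable g)
    (hh : SliceIntegrable h) (a : ℝ) : SliceIntegrable fun q => g q + a * h q :=
  ⟨hg.1.add (hh.1.const_mul a), fun s hs => (hg.2 s hs).add ((hh.2 s hs).const_mul a)⟩

theorem SliceIntegrable.testFn (φ : TestFn) : SliceIntegrable φ.1 := by
  refine ⟨φ.2.1.continuous.measurable, fun s _ => ?_⟩
  refine Continuous.integrable_of_hasCompactSupport (by
    have := φ.2.1.continuous
    fun_prop) ?_
  obtain ⟨A, R, hA⟩ := exists_bound_support φ.2.1.continuous φ.2.2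
  refine HasCompactSupport.of_support_subset_isCompact (isCompact_closedBall (0 : E3) R) ?_
  intro y hy
  simpa using ((hA (s, y)).2 hy).2

/-- A quasi-triangle inequality with constant `2`. It replaces continuity of the norm in all later
limits, at the price of harmless numerical factors. -/
theorem integrandNormSq_add_smul_le {fhat : E3 → ℝ} (hf : LocallyIntegrable fhat)
    {g h : ℝ × E3 → ℝ} (hg : SliceIntegrable g) (hh : SliceIntegrable h) (a : ℝ) :
    integrandNormSq fhat (fun q => g q + a * h q) ≤
      2 * integrandNormSq fhat g + 2 * ENNReal.ofReal (a ^ 2) * integrandNormSq fhat h := by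
  have hfm : AEMeasurable (fun z => ENNReal.ofReal (fhat z)) :=
    hf.aestronglyMeasurable.aemeasurable.ennreal_ofReal
  -- `fhat` is only almost everywhere measurable; a measurable version is needed to split the
  -- integrals.
  obtain ⟨ρ, hρm, hρ⟩ := hfm
  have key : ∀ k : ℝ × E3 → ℝ, integrandNormSq fhat k = ENNReal.ofReal ((2 * Real.pi) ^ (-3 : ℝ)) *
      ∫⁻ s in Ioi (0 : ℝ), ∫⁻ z : E3, ‖fourier (fun y => (k (s, y) : ℂ)) z‖ₑ ^ 2 * ρ z := by
    intro k
    rw [integrandNormSq]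
    congr 1
    refine lintegral_congr fun s => lintegral_congr_ae ?_
    filter_upwards [hρ] with z hz
    rw [hz]
  rw [mul_assoc, ← integrandNormSq_const_mul, key, key, key]
  have hm : ∀ k : ℝ × E3 → ℝ, SliceIntegrable k → Measurable fun p : ℝ × E3 =>
      ‖fourier (fun y => (k (p.1, y) : ℂ)) p.2‖ₑ ^ 2 * ρ p.2 := fun k hk =>
    ((measurable_fourier hk.1).enorm.pow_const 2).mul (hρm.comp measurable_snd)
  calc _ ≤ ENNReal.ofReal ((2 * Real.pi) ^ (-3 : ℝ)) *
        ∫⁻ s in Ioi (0 : ℝ), (2 * (∫⁻ z : E3, ‖fourier (fun y => (g (s, y) : ℂ)) z‖ₑ ^ 2 * ρ z) +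
          2 * ∫⁻ z : E3, ‖fourier (fun y => ((a * h (s, y) : ℝ) : ℂ)) z‖ₑ ^ 2 * ρ z) := by
        refine mul_le_mul' le_rfl ?_
        refine setLIntegral_mono_ae' measurableSet_Ioi (ae_of_all _ fun s hs => ?_)
        rw [← lintegral_const_mul' (2 : ℝ≥0∞) _ ENNReal.ofNat_ne_top,
          ← lintegral_const_mul' (2 : ℝ≥0∞) _ ENNReal.ofNat_ne_top, ← lintegral_add_left]
        · refine lintegral_mono fun z => ?_
          dsimp only
          rw [fourier_add_smul (hg.2 s hs) (hh.2 s hs), fourier_const_mul, ← mul_assoc, ← mul_assoc,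
            ← add_mul]
          gcongr
          exact enorm_add_sq_le _ _
        · exact ((hm g hg).comp measurable_prodMk_left).const_mul 2
    _ = _ := by
        rw [lintegral_add_left, lintegral_const_mul' (2 : ℝ≥0∞) _ ENNReal.ofNat_ne_top,
          lintegral_const_mul' (2 : ℝ≥0∞) _ ENNReal.ofNat_ne_top]
        · ring
        · exact ((hm g hg).lintegral_prod_right' (ν := volume)).const_mul 2

/-! ### Linearity and Gaussianity of Wiener integrals. -/

/-- The test function `φ + a ψ`. -/
def addSMul (φ : TestFn) (a : ℝ) (ψ : TestFn) : TestFn :=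
  ⟨fun q => φ.1 q + a * ψ.1 q, φ.2.1.add (contDiff_const.mul ψ.2.1), φ.2.2.add ψ.2.2.mul_left⟩

section Noise

variable {Ω : Type*} [MeasurableSpace Ω] {P : Measure Ω} {f fhat : E3 → ℝ} {η : TestFn → Ω → ℝ}

theorem IsNoise.memLp (hη : IsNoise P f η) (φ : TestFn) : MemLp (η φ) 2 P :=
  (hη.isGaussianProcess.hasGaussianLaw_eval φ).memLp_two

theorem IsNoise.cov_addSMul (hη : IsNoise P f η) (hf : LocallyIntegrable f) (φ ψ χ : TestFn)
    (a : ℝ) : cov[η (addSMul φ a ψ), η χ; P] = cov[η φ, η χ; P] + a * cov[η ψ, η χ; P] := by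
  have h := fun φ χ : TestFn =>
    integral_covKernel hf φ.2.1.continuous φ.2.2 χ.2.1.continuous χ.2.2
  have hi := fun φ χ : TestFn =>
    integrable_covKernel hf φ.2.1.continuous φ.2.2 χ.2.1.continuous χ.2.2
  rw [hη.cov, hη.cov, hη.cov, ← h, ← h, ← h, ← integral_const_mul,
    ← integral_add (hi _ _) ((hi _ _).const_mul a)]
  refine integral_congr_ae (ae_of_all _ fun p => ?_)
  simp only [addSMul]
  ring

/-- The noise is almost surely linear on test functions. -/
theorem IsNoise.addSMul_ae [IsProbabilityMeasure P] (hη : IsNoise P f η)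
    (hf : LocallyIntegrable f) (φ ψ : TestFn) (a : ℝ) :
    η (addSMul φ a ψ) =ᵐ[P] η φ + a • η ψ := by
  -- The defect `T` is uncorrelated with every `η χ`, hence with itself, being a combination of such
  -- variables; it is also centered, so it vanishes almost surely.
  set T := η (addSMul φ a ψ) - (η φ + a • η ψ) with hT
  have m := hη.memLp
  have mS : MemLp (η φ + a • η ψ) 2 P := (m φ).add ((m ψ).const_smul a)
  have mT : MemLp T 2 P := (m _).sub mS
  have h1 : ∀ χ, cov[T, η χ; P] = 0 := by
    intro χ
    rw [hT, covariance_sub_left (m _) mS (m χ),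
      covariance_add_left (m φ) ((m ψ).const_smul a) (m χ),
      covariance_smul_left, hη.cov_addSMul hf]
    ring
  have h2 : cov[T, T; P] = 0 := by
    conv_lhs => rw [hT]
    rw [← hT, covariance_comm, hT, covariance_sub_right, ← hT, h1]
    · rw [covariance_add_right mT (m φ) ((m ψ).const_smul a), covariance_smul_right, h1, h1]
      ring
    · exact mT
    · exact m _
    · exact mS
  have hmean : ∫ ω, T ω ∂P = 0 := by
    have hi := fun φ => (m φ).integrable (by norm_num : (1 : ℝ≥0∞) ≤ 2)
    rw [hT, integral_sub' (hi _) (mS.integrable (by norm_num)), integral_add' (hi _)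
      ((hi _).smul a)]
    simp only [Pi.smul_apply, integral_smul, hη.mean]
    simp
  rw [covariance_self mT.1.aemeasurable] at h2
  have h3 : T =ᵐ[P] fun _ => P[T] := by
    rw [← evariance_eq_zero_iff mT.1.aemeasurable, ← mT.ofReal_variance_eq, h2, ENNReal.ofReal_zero]
  filter_upwards [h3] with ω hω
  rw [hmean] at hω
  exact sub_eq_zero.1 hω

/-- Wiener integrals are linear in the integrand. -/
theorem IsWienerIntegral.addSMul [IsProbabilityMeasure P] (hη : IsNoise P f η)
    (hf : IsFourierTransform f fhat) {g h : ℝ × E3 → ℝ} {X Y : Ω → ℝ}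
    (hX : IsWienerIntegral P fhat η g X) (hY : IsWienerIntegral P fhat η h Y) (a : ℝ) :
    IsWienerIntegral P fhat η (fun q => g q + a * h q) (fun ω => X ω + a * Y ω) := by
  obtain ⟨gm, gi, mX, φ, hφ1, hφ2⟩ := hX
  obtain ⟨hm, hi, mY, ψ, hψ1, hψ2⟩ := hY
  have hg : SliceIntegrable g := ⟨gm, gi⟩
  have hh : SliceIntegrable h := ⟨hm, hi⟩
  have hsub : ∀ (φ : TestFn) {g}, SliceIntegrable g → SliceIntegrable fun q => φ.1 q - g q := by
    intro φ g hg
    simpa [sub_eq_add_neg] using (SliceIntegrable.testFn φ).add_smul hg (-1)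
  refine ⟨(hg.add_smul hh a).1, (hg.add_smul hh a).2, mX.add (mY.const_mul a),
    fun n => LinearSHE.addSMul (φ n) a (ψ n), ?_, ?_⟩
  · have hlim := (ENNReal.Tendsto.const_mul (a := 2) hφ1 (Or.inr (by simp))).add
      (ENNReal.Tendsto.const_mul (a := 2 * ENNReal.ofReal (a ^ 2)) hψ1
        (Or.inr (ENNReal.mul_ne_top (by simp) ENNReal.ofReal_ne_top)))
    rw [mul_zero, mul_zero, add_zero] at hlim
    refine tendsto_of_tendsto_of_tendsto_of_le_of_le tendsto_const_nhds hlim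
      (fun _ => zero_le) fun n => ?_
    have := integrandNormSq_add_smul_le hf.locallyIntegrable_hat (hsub (φ n) hg) (hsub (ψ n) hh) a
    refine le_trans (le_of_eq ?_) this
    congr 1
    ext q
    simp only [LinearSHE.addSMul]
    ring
  · have hlim := hφ2.add (ENNReal.Tendsto.const_mul (a := ‖a‖ₑ) hψ2 (Or.inr (by simp)))
    rw [mul_zero, add_zero] at hlim
    refine tendsto_of_tendsto_of_tendsto_of_le_of_le tendsto_const_nhds hlim
      (fun _ => zero_le) fun n => ?_
    have m := hη.memLp
    have hae : (fun ω => η (LinearSHE.addSMul (φ n) a (ψ n)) ω - (X ω + a * Y ω)) =ᵐ[P]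
        (fun ω => η (φ n) ω - X ω) + a • (fun ω => η (ψ n) ω - Y ω) := by
      filter_upwards [hη.addSMul_ae hf.locallyIntegrable (φ n) (ψ n) a] with ω hω
      rw [hω]
      simp only [Pi.add_apply, Pi.smul_apply, smul_eq_mul]
      ring
    dsimp only
    rw [eLpNorm_congr_ae hae, ← eLpNorm_const_smul]
    exact eLpNorm_add_le ((m _).1.sub mX.1) (((m _).1.sub mY.1).const_smul a) (by norm_num)

theorem IsWienerIntegral.zero [IsProbabilityMeasure P] (hη : IsNoise P f η)
    (hf : IsFourierTransform f fhat) :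
    IsWienerIntegral P fhat η (fun _ => 0) (fun _ => 0) := by
  let o : TestFn := ⟨fun _ => 0, contDiff_const, HasCompactSupport.zero⟩
  -- Since `o = o + (-1) o`, almost sure linearity gives `η o = η o - η o = 0`.
  have ho : LinearSHE.addSMul o (-1) o = o := by
    apply Subtype.ext
    ext q
    simp [LinearSHE.addSMul, o]
  have hae : η o =ᵐ[P] 0 := by
    have := hη.addSMul_ae hf.locallyIntegrable o o (-1)
    rw [ho] at this
    filter_upwards [this] with ω hω
    simpa using hω
  refine ⟨measurable_const, fun _ _ => integrable_zero _ _ _, MemLp.zero' , fun _ => o, ?_, ?_⟩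
  · simp [o, integrandNormSq, fourier]
  · simp only [sub_zero]
    rw [eLpNorm_congr_ae hae]
    simp

theorem IsWienerIntegral.sum [IsProbabilityMeasure P] (hη : IsNoise P f η)
    (hf : IsFourierTransform f fhat) {ι : Type*} (S : Finset ι) {g : ι → ℝ × E3 → ℝ}
    {X : ι → Ω → ℝ} (hX : ∀ i, IsWienerIntegral P fhat η (g i) (X i)) (ξ : ι → ℝ) :
    IsWienerIntegral P fhat η (fun q => ∑ i ∈ S, ξ i * g i q) (fun ω => ∑ i ∈ S, ξ i * X i ω) := by
  classical
  induction S using Finset.induction_on with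
  | empty => simpa using IsWienerIntegral.zero hη hf
  | insert i S hi ih =>
    simp_rw [Finset.sum_insert hi, add_comm (ξ i * _)]
    exact ih.addSMul hη hf (hX i) (ξ i)

theorem IsNoise.ofReal_integral_sq [IsProbabilityMeasure P] (hη : IsNoise P f η)
    (hf : IsFourierTransform f fhat) (hpos : ∀ z, 0 < fhat z) (φ : TestFn) :
    ENNReal.ofReal (∫ ω, η φ ω ^ 2 ∂P) = integrandNormSq fhat φ.1 := by
  rw [integrandNormSq_eq hf hpos φ.2.1 φ.2.2, ← hη.cov,
    covariance_self (hη.memLp φ).1.aemeasurable, variance_of_integral_eq_zero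
    (hη.memLp φ).1.aemeasurable (hη.mean φ)]

theorem tendsto_integral_sq {Y : ℕ → Ω → ℝ} {X : Ω → ℝ} (hY : ∀ n, MemLp (Y n) 2 P)
    (hX : MemLp X 2 P) (h : Tendsto (fun n => eLpNorm (fun ω => Y n ω - X ω) 2 P) atTop (𝓝 0)) :
    Tendsto (fun n => ∫ ω, Y n ω ^ 2 ∂P) atTop (𝓝 (∫ ω, X ω ^ 2 ∂P)) := by
  have key : ∀ {Z : Ω → ℝ} (hZ : MemLp Z 2 P),
      ∫ ω, Z ω ^ 2 ∂P = inner ℝ (hZ.toLp Z) (hZ.toLp Z) := by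
    intro Z hZ
    rw [L2.inner_def]
    refine integral_congr_ae ?_
    filter_upwards [hZ.coeFn_toLp] with ω hω
    rw [hω, real_inner_self_eq_norm_sq, Real.norm_eq_abs, sq_abs]
  have hT := (Lp.tendsto_Lp_iff_tendsto_eLpNorm'' Y hY X hX).2 h
  simp_rw [fun n => key (hY n), key hX]
  exact hT.inner hT

theorem IsNoise.integral_cexp [IsProbabilityMeasure P] (hη : IsNoise P f η) (φ : TestFn) :
    ∫ ω, Complex.exp (Complex.I * (η φ ω : ℂ)) ∂P =
      Complex.exp (-((∫ ω, η φ ω ^ 2 ∂P : ℝ) : ℂ) / 2) := by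
  have h := (hη.isGaussianProcess.hasGaussianLaw_eval φ).charFun_map_eq 1
  rw [charFun_apply, integral_map (hη.memLp φ).1.aemeasurable (by fun_prop)] at h
  simp only [RCLike.inner_apply, conj_trivial, mul_one, one_mul, hη.mean] at h
  rw [variance_of_integral_eq_zero (hη.memLp φ).1.aemeasurable (hη.mean φ)] at h
  simp_rw [mul_comm Complex.I]
  rw [h]
  congr 1
  simp [neg_div]

theorem norm_cexp_sub_le (a b : ℝ) :
    ‖Complex.exp (Complex.I * (a : ℂ)) - Complex.exp (Complex.I * (b : ℂ))‖ ≤ ‖a - b‖ := by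
  have h : Complex.exp (Complex.I * (a : ℂ)) - Complex.exp (Complex.I * (b : ℂ)) =
      Complex.exp (Complex.I * (b : ℂ)) * (Complex.exp (Complex.I * ((a - b : ℝ) : ℂ)) - 1) := by
    rw [mul_sub, ← Complex.exp_add]
    push_cast
    ring_nf
  rw [h, norm_mul, mul_comm Complex.I (b : ℂ), Complex.norm_exp_ofReal_mul_I, one_mul]
  exact Real.norm_exp_I_mul_ofReal_sub_one_le

/-- A Wiener integral is a centered Gaussian variable. -/
theorem IsWienerIntegral.integral_cexp [IsProbabilityMeasure P] (hη : IsNoise P f η)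
    {g : ℝ × E3 → ℝ} {X : Ω → ℝ} (hX : IsWienerIntegral P fhat η g X) :
    ∫ ω, Complex.exp (Complex.I * (X ω : ℂ)) ∂P =
      Complex.exp (-((∫ ω, X ω ^ 2 ∂P : ℝ) : ℂ) / 2) := by
  obtain ⟨-, -, mX, φ, -, hφ⟩ := hX
  have m := fun n => hη.memLp (φ n)
  have hmeas : ∀ {Y : Ω → ℝ}, MemLp Y 2 P →
      AEStronglyMeasurable (fun ω => Complex.exp (Complex.I * (Y ω : ℂ))) P := fun hY =>
    (by fun_prop : Continuous fun y : ℝ =>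
      Complex.exp (Complex.I * (y : ℂ))).comp_aestronglyMeasurable hY.1
  have h1 : Tendsto (fun n => ∫ ω, Complex.exp (Complex.I * (η (φ n) ω : ℂ)) ∂P) atTop
      (𝓝 (∫ ω, Complex.exp (Complex.I * (X ω : ℂ)) ∂P)) := by
    -- `x ↦ exp (i x)` is `1`-Lipschitz, so convergence in `L²`, hence in `L¹`, passes to the
    -- exponentials.
    refine tendsto_integral_of_L1' _ (hmeas mX) (Eventually.of_forall fun n => ?_) ?_
    · refine Integrable.of_bound (hmeas (m n)) 1 (ae_of_all _ fun ω => ?_)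
      rw [mul_comm, Complex.norm_exp_ofReal_mul_I]
    · refine tendsto_of_tendsto_of_tendsto_of_le_of_le tendsto_const_nhds hφ
        (fun _ => zero_le) fun n => ?_
      refine (eLpNorm_mono (g := fun ω => η (φ n) ω - X ω) fun ω => norm_cexp_sub_le _ _).trans ?_
      exact eLpNorm_le_eLpNorm_of_exponent_le (by norm_num) ((m n).1.sub mX.1)
  have h2 := (tendsto_integral_sq m mX hφ)
  have h3 : Tendsto (fun n => Complex.exp (-((∫ ω, η (φ n) ω ^ 2 ∂P : ℝ) : ℂ) / 2)) atTop
      (𝓝 (Complex.exp (-((∫ ω, X ω ^ 2 ∂P : ℝ) : ℂ) / 2))) :=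
    ((by fun_prop : Continuous fun v : ℝ => Complex.exp (-(v : ℂ) / 2)).tendsto _).comp h2
  refine tendsto_nhds_unique h1 ?_
  simpa only [hη.integral_cexp] using h3

/-- The second moment of a Wiener integral is comparable to the squared norm of its integrand. -/
theorem IsWienerIntegral.integrandNormSq_comparable [IsProbabilityMeasure P] (hη : IsNoise P f η)
    (hf : IsFourierTransform f fhat) (hpos : ∀ z, 0 < fhat z)
    {g : ℝ × E3 → ℝ} {X : Ω → ℝ} (hX : IsWienerIntegral P fhat η g X) :
    integrandNormSq fhat g ≤ 2 * ENNReal.ofReal (∫ ω, X ω ^ 2 ∂P) ∧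
      ENNReal.ofReal (∫ ω, X ω ^ 2 ∂P) ≤ 2 * integrandNormSq fhat g := by
  obtain ⟨gm, gi, mX, φ, hφ1, hφ⟩ := hX
  have hg : SliceIntegrable g := ⟨gm, gi⟩
  have h2 : Tendsto (fun n => integrandNormSq fhat (φ n).1) atTop
      (𝓝 (ENNReal.ofReal (∫ ω, X ω ^ 2 ∂P))) := by
    have := ENNReal.tendsto_ofReal (tendsto_integral_sq (fun n => hη.memLp (φ n)) mX hφ)
    simpa only [hη.ofReal_integral_sq hf hpos] using this
  have hsub : ∀ φ : TestFn, SliceIntegrable fun q => φ.1 q - g q := by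
    intro φ
    simpa [sub_eq_add_neg] using (SliceIntegrable.testFn φ).add_smul hg (-1)
  have hφ2 := ENNReal.Tendsto.const_mul (a := 2) hφ1 (Or.inr (by simp))
  rw [mul_zero] at hφ2
  constructor
  · have hlim := (ENNReal.Tendsto.const_mul (a := 2) h2 (Or.inr (by simp))).add hφ2
    rw [add_zero] at hlim
    refine ge_of_tendsto' hlim fun n => ?_
    have := integrandNormSq_add_smul_le hf.locallyIntegrable_hat (SliceIntegrable.testFn (φ n))
      (hsub (φ n)) (-1)
    simpa using this
  · have hlim := hφ2.add (tendsto_const_nhds (x := 2 * integrandNormSq fhat g))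
    rw [zero_add] at hlim
    refine le_of_tendsto_of_tendsto' h2 hlim fun n => ?_
    have := integrandNormSq_add_smul_le hf.locallyIntegrable_hat (hsub (φ n)) hg 1
    simpa using this

end Noise

/-! ### Fourier transform of heat kernels. -/

theorem integrable_heatKernel_sub {τ : ℝ} (hτ : 0 < τ) (x : E3) :
    Integrable fun y : E3 => heatKernel τ (y - x) := by
  refine Integrable.comp_sub_right (f := heatKernel τ) ?_ x
  have hb : 0 < (((2 * τ)⁻¹ : ℝ) : ℂ).re := by rw [Complex.ofReal_re]; positivity
  have h := (GaussianFourier.integrable_cexp_neg_mul_sq_norm_add hb 0 (0 : E3)).norm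
  refine (h.const_mul ((2 * Real.pi * τ) ^ (-(3 / 2) : ℝ))).congr (ae_of_all _ fun y => ?_)
  simp only [heatKernel]
  congr 1
  rw [Complex.norm_exp]
  congr 1
  have : (-(((2 * τ)⁻¹ : ℝ) : ℂ) * (‖y‖ : ℂ) ^ 2 + 0 * ((inner ℝ (0 : E3) y : ℝ) : ℂ)) =
      ((-‖y‖ ^ 2 / (2 * τ) : ℝ) : ℂ) := by
    push_cast
    ring
  rw [this, Complex.ofReal_re]

theorem fourier_heatKernel_sub {τ : ℝ} (hτ : 0 < τ) (x z : E3) :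
    fourier (fun y => (heatKernel τ (y - x) : ℂ)) z =
      Complex.exp (Complex.I * ((inner ℝ x z : ℝ) : ℂ)) *
        ((Real.exp (-(τ * ‖z‖ ^ 2) / 2) : ℝ) : ℂ) := by
  have hb : 0 < (((2 * τ)⁻¹ : ℝ) : ℂ).re := by rw [Complex.ofReal_re]; positivity
  have h := GaussianFourier.integral_cexp_neg_mul_sq_norm_add hb Complex.I z
  rw [fourier, ← integral_add_right_eq_self _ x]
  have e1 : ∀ y : E3, Complex.exp (Complex.I * ((inner ℝ (y + x) z : ℝ) : ℂ)) *
      (heatKernel τ (y + x - x) : ℂ) =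
      (((2 * Real.pi * τ) ^ (-(3 / 2) : ℝ) : ℝ) : ℂ) *
        Complex.exp (Complex.I * ((inner ℝ x z : ℝ) : ℂ)) *
      Complex.exp (-(((2 * τ)⁻¹ : ℝ) : ℂ) * (‖y‖ : ℂ) ^ 2 +
        Complex.I * ((inner ℝ z y : ℝ) : ℂ)) := by
    intro y
    rw [add_sub_cancel_right, heatKernel, inner_add_left, real_inner_comm y z, Complex.exp_add]
    push_cast
    rw [mul_add, Complex.exp_add]
    have : -(2 * (τ : ℂ))⁻¹ * (‖y‖ : ℂ) ^ 2 = -(‖y‖ : ℂ) ^ 2 / (2 * τ) := by ring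
    rw [this]
    ring
  simp_rw [e1]
  rw [integral_const_mul, h]
  have e2 : ((Real.pi : ℂ) / (((2 * τ)⁻¹ : ℝ) : ℂ)) ^ ((Module.finrank ℝ E3 : ℂ) / 2) =
      (((2 * Real.pi * τ) ^ (3 / 2 : ℝ) : ℝ) : ℂ) := by
    rw [finrank_euclideanSpace_fin, Complex.ofReal_cpow (by positivity)]
    congr 1
    · push_cast
      rw [div_inv_eq_mul]
      ring
    · norm_num
  have e3 : Complex.I ^ 2 * (‖z‖ : ℂ) ^ 2 / (4 * (((2 * τ)⁻¹ : ℝ) : ℂ)) =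
      ((-(τ * ‖z‖ ^ 2) / 2 : ℝ) : ℂ) := by
    have : (τ : ℂ) ≠ 0 := by exact_mod_cast hτ.ne'
    rw [Complex.I_sq]
    push_cast
    field_simp
    norm_num
  rw [e2, e3, ← Complex.ofReal_exp]
  have e4 : (((2 * Real.pi * τ) ^ (-(3 / 2) : ℝ) : ℝ) : ℂ) *
      (((2 * Real.pi * τ) ^ (3 / 2 : ℝ) : ℝ) : ℂ) = 1 := by
    rw [← Complex.ofReal_mul, ← Real.rpow_add (by positivity)]
    norm_num
  linear_combination (Complex.exp (Complex.I * ((inner ℝ x z : ℝ) : ℂ)) *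
        ((Real.exp (-(τ * ‖z‖ ^ 2) / 2) : ℝ) : ℂ)) * e4

theorem heatIntegrand_of_mem {t s : ℝ} (hs : s ∈ Ioo 0 t) (x y : E3) :
    heatIntegrand t x (s, y) = heatKernel (t - s) (y - x) :=
  indicator_of_mem hs _

theorem fourier_sum_heatIntegrand {t s : ℝ} (hs : s ∈ Ioo 0 t) {ι : Type*} (S : Finset ι)
    (ξ : ι → ℝ) (x : ι → E3) (z : E3) :
    fourier (fun y => ((∑ j ∈ S, ξ j * heatIntegrand t (x j) (s, y) : ℝ) : ℂ)) z =
      (∑ j ∈ S, (ξ j : ℂ) * Complex.exp (Complex.I * ((inner ℝ (x j) z : ℝ) : ℂ))) *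
        ((Real.exp (-((t - s) * ‖z‖ ^ 2) / 2) : ℝ) : ℂ) := by
  simp only [heatIntegrand_of_mem hs]
  have hτ : 0 < t - s := sub_pos.2 hs.2
  have e1 : ∀ y : E3, Complex.exp (Complex.I * ((inner ℝ y z : ℝ) : ℂ)) *
      ((∑ j ∈ S, ξ j * heatKernel (t - s) (y - x j) : ℝ) : ℂ) =
      ∑ j ∈ S, (ξ j : ℂ) * (Complex.exp (Complex.I * ((inner ℝ y z : ℝ) : ℂ)) *
        (heatKernel (t - s) (y - x j) : ℂ)) := by
    intro y
    push_cast
    rw [Finset.mul_sum]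
    exact Finset.sum_congr rfl fun j _ => by ring
  have hint : ∀ j, Integrable fun y => (heatKernel (t - s) (y - x j) : ℂ) := fun j =>
    (integrable_heatKernel_sub hτ (x j)).ofReal
  rw [fourier]
  simp_rw [e1]
  rw [integral_finsetSum _ fun j _ => (integrable_fourier_integrand (hint j) z).const_mul _,
    Finset.sum_mul]
  refine Finset.sum_congr rfl fun j _ => ?_
  rw [integral_const_mul, mul_assoc, ← fourier_heatKernel_sub hτ, fourier]

/-- Translation multiplies the Fourier transform by a factor of modulus one. -/
theorem integrandNormSq_heatIntegrand (fhat : E3 → ℝ) (t : ℝ) (x : E3) :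
    integrandNormSq fhat (heatIntegrand t x) = integrandNormSq fhat (heatIntegrand t 0) := by
  simp only [integrandNormSq]
  congr 1
  refine setLIntegral_congr_fun measurableSet_Ioi fun s hs => lintegral_congr fun z => ?_
  congr 2
  by_cases hst : s ∈ Ioo 0 t
  · simp only [heatIntegrand_of_mem hst]
    rw [fourier_heatKernel_sub (sub_pos.2 hst.2), fourier_heatKernel_sub (sub_pos.2 hst.2),
      enorm_mul, enorm_mul]
    congr 1
    rw [← ofReal_norm, ← ofReal_norm, mul_comm, mul_comm Complex.I, Complex.norm_exp_ofReal_mul_I,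
      Complex.norm_exp_ofReal_mul_I]
  · simp [heatIntegrand, hst, fourier]

/-! ### Energy of grid combinations in high-frequency boxes. -/

/-- Squared modulus of the trigonometric polynomial `∑ ξⱼ exp(i j δ x)`. -/
def trigSq {N : ℕ} (ξ : Fin N → ℝ) (δ x : ℝ) : ℝ :=
  (∑ j, ξ j * Real.cos (j * δ * x)) ^ 2 + (∑ j, ξ j * Real.sin (j * δ * x)) ^ 2

theorem continuous_trigSq {N : ℕ} (ξ : Fin N → ℝ) (δ : ℝ) : Continuous (trigSq ξ δ) := by
  unfold trigSq
  fun_prop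

theorem trigSq_nonneg {N : ℕ} (ξ : Fin N → ℝ) (δ x : ℝ) : 0 ≤ trigSq ξ δ x := by
  unfold trigSq
  positivity

/-- Orthogonality of the exponentials over whole periods. -/
theorem integral_trigSq {N : ℕ} (ξ : Fin N → ℝ) {δ a : ℝ} (hδ : 0 < δ) (m : ℤ)
    (ha : a * δ = 2 * Real.pi * m) :
    ∫ x in a..(2 * a), trigSq ξ δ x = a * ∑ j, ξ j ^ 2 := by
  have h1 : ∀ x, trigSq ξ δ x =
      ∑ i, ∑ j, ξ i * ξ j * Real.cos ((((i : ℤ) - (j : ℤ) : ℤ) : ℝ) * δ * x) := by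
    intro x
    rw [trigSq, sq, sq, Finset.sum_mul_sum, Finset.sum_mul_sum, ← Finset.sum_add_distrib]
    refine Finset.sum_congr rfl fun i _ => ?_
    rw [← Finset.sum_add_distrib]
    refine Finset.sum_congr rfl fun j _ => ?_
    have : (((i : ℤ) - (j : ℤ) : ℤ) : ℝ) * δ * x = i * δ * x - j * δ * x := by push_cast; ring
    rw [this, Real.cos_sub]
    ring
  have h2 : ∀ n : ℤ, n ≠ 0 → ∫ x in a..(2 * a), Real.cos ((n : ℝ) * δ * x) = 0 := by
    intro n hn
    have hn' : (n : ℝ) * δ ≠ 0 := mul_ne_zero (by exact_mod_cast hn) hδ.ne'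
    rw [intervalIntegral.integral_comp_mul_left _ hn', integral_cos]
    have e1 : (n : ℝ) * δ * a = ((2 * m * n : ℤ) : ℝ) * Real.pi := by
      push_cast
      linear_combination (n : ℝ) * ha
    have e2 : (n : ℝ) * δ * (2 * a) = ((4 * m * n : ℤ) : ℝ) * Real.pi := by
      push_cast
      linear_combination 2 * (n : ℝ) * ha
    rw [e1, e2, Real.sin_int_mul_pi, Real.sin_int_mul_pi]
    simp
  simp_rw [h1]
  have hint : ∀ i j : Fin N, IntervalIntegrable
      (fun x => ξ i * ξ j * Real.cos ((((i : ℤ) - (j : ℤ) : ℤ) : ℝ) * δ * x)) volume a (2 * a) :=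
    fun i j => Continuous.intervalIntegrable (by fun_prop) _ _
  rw [intervalIntegral.integral_finsetSum fun i _ => by
    simpa only [Finset.sum_fn] using IntervalIntegrable.sum Finset.univ fun j _ => hint i j]
  rw [Finset.mul_sum]
  refine Finset.sum_congr rfl fun i _ => ?_
  rw [intervalIntegral.integral_finsetSum fun j _ => hint i j, Finset.sum_eq_single i]
  · rw [intervalIntegral.integral_const_mul]
    simp
    ring
  · intro j _ hj
    rw [intervalIntegral.integral_const_mul, h2 _ (by
      rw [sub_ne_zero]
      intro h
      exact hj (Fin.ext (by exact_mod_cast h.symm))), mul_zero]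
  · simp

/-- The box `[a, 2a) × [0, a)²`. -/
def box (a : ℝ) : Set E3 := {z | z 0 ∈ Ico a (2 * a) ∧ z 1 ∈ Ico 0 a ∧ z 2 ∈ Ico 0 a}

theorem measurableSet_box (a : ℝ) : MeasurableSet (box a) := by
  have h : ∀ i : Fin 3, Measurable fun z : E3 => z i := fun i => by fun_prop
  exact ((h 0) measurableSet_Ico).inter (((h 1) measurableSet_Ico).inter ((h 2) measurableSet_Ico))

theorem norm_bounds_of_mem_box {a : ℝ} (ha : 0 < a) {z : E3} (hz : z ∈ box a) :
    a ≤ ‖z‖ ∧ ‖z‖ ≤ 3 * a := by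
  obtain ⟨⟨h0, h0'⟩, ⟨h1, h1'⟩, ⟨h2, h2'⟩⟩ := hz
  have hn : ‖z‖ ^ 2 = z 0 ^ 2 + z 1 ^ 2 + z 2 ^ 2 := by
    rw [EuclideanSpace.norm_sq_eq]
    simp [Fin.sum_univ_three]
  constructor
  · refine le_of_sq_le_sq ?_ (norm_nonneg z)
    nlinarith [sq_nonneg (z 1), sq_nonneg (z 2)]
  -- On the box `‖z‖² ≤ 4a² + a² + a² ≤ 9a²`.
  · refine le_of_sq_le_sq ?_ (by positivity)
    nlinarith

theorem lintegral_box {N : ℕ} (ξ : Fin N → ℝ) {δ a : ℝ} (hδ : 0 < δ) (ha0 : 0 < a) (m : ℤ)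
    (ha : a * δ = 2 * Real.pi * m) :
    ∫⁻ z in box a, ENNReal.ofReal (trigSq ξ δ (z 0)) =
      ENNReal.ofReal (a ^ 3 * ∑ j, ξ j ^ 2) := by
  let F : Fin 3 → ℝ → ℝ := ![(Ico a (2 * a)).indicator (trigSq ξ δ),
    (Ico 0 a).indicator 1, (Ico 0 a).indicator 1]
  have hF : ∀ i, Integrable (F i) := by
    have h1 : Integrable ((Ico (0 : ℝ) a).indicator (1 : ℝ → ℝ)) :=
      (integrable_indicator_iff measurableSet_Ico).2 (integrableOn_const (by simp))
    have h0 : Integrable ((Ico a (2 * a)).indicator (trigSq ξ δ)) :=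
      (integrable_indicator_iff measurableSet_Ico).2
        ((continuous_trigSq ξ δ).integrableOn_Icc.mono_set Ico_subset_Icc_self)
    intro i
    fin_cases i
    · exact h0
    · exact h1
    · exact h1
  have hFpos : ∀ i x, 0 ≤ F i x := by
    intro i x
    fin_cases i
    · exact indicator_nonneg (fun x _ => trigSq_nonneg ξ δ x) x
    · exact indicator_nonneg (fun x _ => zero_le_one) x
    · exact indicator_nonneg (fun x _ => zero_le_one) x
  -- The integrand depends on `z 0` alone, so the box integral factors into three one-dimensional
  -- ones.
  have hprod : ∀ z : E3, (box a).indicator (fun z => ENNReal.ofReal (trigSq ξ δ (z 0))) z =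
      ENNReal.ofReal (∏ i, F i (z i)) := by
    intro z
    rw [Fin.prod_univ_three]
    simp only [F, Matrix.cons_val_zero, Matrix.cons_val_one, Matrix.cons_val]
    have hmem : z ∈ box a ↔ z 0 ∈ Ico a (2 * a) ∧ z 1 ∈ Ico 0 a ∧ z 2 ∈ Ico 0 a := Iff.rfl
    by_cases h0 : z 0 ∈ Ico a (2 * a) <;> by_cases h1 : z 1 ∈ Ico 0 a <;>
      by_cases h2 : z 2 ∈ Ico 0 a <;> simp [indicator, hmem, h0, h1, h2, -mem_Ico]
  rw [← lintegral_indicator (measurableSet_box a)]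
  simp_rw [hprod]
  have hmp := (PiLp.volume_preserving_toLp (Fin 3)).symm (MeasurableEquiv.toLp 2 (Fin 3 → ℝ))
  have h3 := hmp.lintegral_comp_emb (MeasurableEquiv.measurableEmbedding _)
    (fun x : Fin 3 → ℝ => ENNReal.ofReal (∏ i, F i (x i)))
  refine h3.trans ?_
  rw [volume_pi, ← ofReal_integral_eq_lintegral_ofReal (Integrable.fintype_prod hF)
    (ae_of_all _ fun x => Finset.prod_nonneg fun i _ => hFpos i _),
    integral_fintype_prod_eq_prod, Fin.prod_univ_three]
  simp only [F, Matrix.cons_val_zero, Matrix.cons_val_one, Matrix.cons_val]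
  rw [integral_indicator measurableSet_Ico, integral_indicator_one measurableSet_Ico,
    integral_Ico_eq_integral_Ioc, ← intervalIntegral.integral_of_le (by linarith),
    integral_trigSq ξ hδ m ha]
  congr 1
  simp [Measure.real, ha0.le]
  ring

/-- Equally spaced points on a line parallel to the first coordinate axis. -/
def gridPoint (c : E3) (δ : ℝ) (j : ℕ) : E3 := c + (j * δ) • EuclideanSpace.single 0 1

theorem inner_gridPoint (c : E3) (δ : ℝ) (j : ℕ) (z : E3) :
    inner ℝ (gridPoint c δ j) z = inner ℝ c z + j * δ * z 0 := by
  rw [gridPoint, inner_add_left, inner_smul_left, EuclideanSpace.inner_single_left]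
  simp

theorem enorm_sum_gridPoint_sq {N : ℕ} (ξ : Fin N → ℝ) (c : E3) (δ : ℝ) (z : E3) :
    ‖∑ j, (ξ j : ℂ) * Complex.exp (Complex.I * ((inner ℝ (gridPoint c δ j) z : ℝ) : ℂ))‖ₑ ^ 2 =
      ENNReal.ofReal (trigSq ξ δ (z 0)) := by
  have h1 : ∑ j, (ξ j : ℂ) * Complex.exp (Complex.I * ((inner ℝ (gridPoint c δ j) z : ℝ) : ℂ)) =
      Complex.exp (((inner ℝ c z : ℝ) : ℂ) * Complex.I) *
        (((∑ j, ξ j * Real.cos (j * δ * z 0) : ℝ) : ℂ) +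
          ((∑ j, ξ j * Real.sin (j * δ * z 0) : ℝ) : ℂ) * Complex.I) := by
    push_cast
    rw [Finset.sum_mul, ← Finset.sum_add_distrib, Finset.mul_sum]
    refine Finset.sum_congr rfl fun j _ => ?_
    rw [inner_gridPoint]
    push_cast
    rw [mul_add, Complex.exp_add, mul_comm Complex.I (_ * _ * _), Complex.exp_mul_I,
      mul_comm Complex.I]
    ring
  rw [h1, enorm_mul, ← ofReal_norm, Complex.norm_exp_ofReal_mul_I, ENNReal.ofReal_one, one_mul,
    ← ofReal_norm, ← ENNReal.ofReal_pow (norm_nonneg _), ← Complex.normSq_eq_norm_sq,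
    Complex.normSq_add_mul_I, trigSq]

/-- Contribution of one frequency box to the squared norm of a combination of heat kernels. -/
theorem energy_box {fhat : E3 → ℝ} {α C : ℝ} (hα : 0 < α) (hC : 1 < C)
    (hfhat : ∀ z : E3, Real.exp 1 ≤ ‖z‖ →
      C⁻¹ * (‖z‖ ^ (-1 : ℝ) * Real.log ‖z‖ ^ (-α)) ≤ fhat z)
    {N : ℕ} (ξ : Fin N → ℝ) (c : E3) {δ a t s : ℝ} (hδ : 0 < δ) (hae : Real.exp 1 ≤ a) (m : ℤ)
    (ha : a * δ = 2 * Real.pi * m) (hat : (9 * a ^ 2)⁻¹ ≤ t) (hs : s ∈ Ioo (t - (9 * a ^ 2)⁻¹) t) :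
    ENNReal.ofReal (Real.exp (-1) * C⁻¹ * 3⁻¹ * Real.log (3 * a) ^ (-α) * a ^ 2 * ∑ j, ξ j ^ 2) ≤
      ∫⁻ z in box a, ‖fourier (fun y =>
        ((∑ j, ξ j * heatIntegrand t (gridPoint c δ j) (s, y) : ℝ) : ℂ)) z‖ₑ ^ 2 *
          ENNReal.ofReal (fhat z) := by
  have ha0 : 0 < a := (Real.exp_pos 1).trans_le hae
  have hst : s ∈ Ioo 0 t := ⟨by linarith [hs.1], hs.2⟩
  set κ : ℝ := Real.exp (-1) * (C⁻¹ * ((3 * a)⁻¹ * Real.log (3 * a) ^ (-α))) with hκ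
  have hlog3 : 0 < Real.log (3 * a) :=
    Real.log_pos (by linarith [Real.add_one_le_exp (1 : ℝ)])
  have hκ0 : 0 ≤ κ := by
    have : 0 < C := by linarith
    positivity
  calc ENNReal.ofReal (Real.exp (-1) * C⁻¹ * 3⁻¹ * Real.log (3 * a) ^ (-α) * a ^ 2 * ∑ j, ξ j ^ 2)
      = ENNReal.ofReal κ * ENNReal.ofReal (a ^ 3 * ∑ j, ξ j ^ 2) := by
        rw [← ENNReal.ofReal_mul hκ0, hκ]
        congr 1
        field_simp
    _ = ∫⁻ z in box a, ENNReal.ofReal κ * ENNReal.ofReal (trigSq ξ δ (z 0)) := by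
        rw [lintegral_const_mul' _ _ ENNReal.ofReal_ne_top, lintegral_box ξ hδ ha0 m ha]
    _ ≤ _ := by
        refine setLIntegral_mono_ae' (measurableSet_box a) (ae_of_all _ fun z hz => ?_)
        obtain ⟨hz1, hz2⟩ := norm_bounds_of_mem_box ha0 hz
        rw [fourier_sum_heatIntegrand hst, enorm_mul, mul_pow, enorm_sum_gridPoint_sq, mul_comm,
          mul_assoc]
        refine mul_le_mul' le_rfl ?_
        rw [← ofReal_norm, Complex.norm_real, Real.norm_of_nonneg (Real.exp_pos _).le,
          ← ENNReal.ofReal_pow (Real.exp_pos _).le, ← ENNReal.ofReal_mul (by positivity), hκ]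
        refine ENNReal.ofReal_le_ofReal (mul_le_mul ?_ ?_ ?_ (by positivity))
        · rw [← Real.exp_nat_mul]
          refine Real.exp_le_exp.2 ?_
          -- The time window is chosen so that `(t - s)‖z‖² ≤ 1` on the box; the squared heat
          -- multiplier is then at least `exp (-1)`.
          have h1 : (t - s) * ‖z‖ ^ 2 ≤ (9 * a ^ 2)⁻¹ * (9 * a ^ 2) := by
            refine mul_le_mul (by linarith [hs.1]) ?_ (by positivity) (by positivity)
            nlinarith [norm_nonneg z]
          rw [inv_mul_cancel₀ (by positivity)] at h1
          push_cast
          linarith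
        · refine le_trans ?_ (hfhat z (hae.trans hz1))
          have hz0 : 0 < ‖z‖ := ha0.trans_le hz1
          have hlog : 0 < Real.log ‖z‖ :=
            Real.log_pos (by linarith [Real.add_one_le_exp (1 : ℝ)])
          rw [Real.rpow_neg_one]
          have : 0 < C := by linarith
          gcongr ?_ * (?_ * ?_)
          · gcongr
          · exact Real.rpow_le_rpow_of_nonpos hlog (Real.log_le_log hz0 hz2) (by linarith)
        · have : 0 < C := by linarith
          positivity

theorem pairwiseDisjoint_box {a₀ : ℝ} (ha₀ : 0 < a₀) (S : Set ℕ) :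
    S.PairwiseDisjoint fun k : ℕ => box (2 ^ k * a₀) := by
  have key : ∀ k l : ℕ, k < l → Disjoint (box (2 ^ k * a₀)) (box (2 ^ l * a₀)) := by
    intro k l hkl
    rw [Set.disjoint_left]
    rintro z ⟨⟨-, h1⟩, -⟩ ⟨⟨h2, -⟩, -⟩
    have : (2 : ℝ) ^ (k + 1) ≤ 2 ^ l := pow_le_pow_right₀ one_le_two hkl
    have h3 := mul_le_mul_of_nonneg_right this ha₀.le
    rw [pow_succ] at h3
    linarith
  intro k _ l _ hkl
  rcases lt_or_gt_of_ne hkl with h | h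
  · exact key k l h
  · exact (key l k h).symm

/-- Sum over `K` dyadic frequency boxes. -/
theorem energy_sum {fhat : E3 → ℝ} {α C : ℝ} (hα : 0 < α) (hC : 1 < C)
    (hfhat : ∀ z : E3, Real.exp 1 ≤ ‖z‖ →
      C⁻¹ * (‖z‖ ^ (-1 : ℝ) * Real.log ‖z‖ ^ (-α)) ≤ fhat z)
    {N : ℕ} (ξ : Fin N → ℝ) (c : E3) {δ a₀ t Λ : ℝ} (hδ : 0 < δ) (hae : Real.exp 1 ≤ a₀)
    (ha : a₀ * δ = 2 * Real.pi) (hat : (9 * a₀ ^ 2)⁻¹ ≤ t) (K : ℕ)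
    (hΛ : Real.log (3 * (2 ^ K * a₀)) ≤ Λ) :
    ENNReal.ofReal ((2 * Real.pi) ^ (-3 : ℝ) * (Real.exp (-1) * C⁻¹ * 27⁻¹) *
      (K * Λ ^ (-α)) * ∑ j, ξ j ^ 2) ≤
      integrandNormSq fhat fun q => ∑ j, ξ j * heatIntegrand t (gridPoint c δ j) q := by
  have hC0 : 0 < C := by linarith
  have ha0 : 0 < a₀ := (Real.exp_pos 1).trans_le hae
  have hsum : 0 ≤ ∑ j, ξ j ^ 2 := Finset.sum_nonneg fun j _ => sq_nonneg _
  have hk1 : ∀ k : ℕ, a₀ ≤ 2 ^ k * a₀ := fun k =>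
    le_mul_of_one_le_left ha0.le (one_le_pow₀ one_le_two)
  have hinv : ∀ k : ℕ, (9 * (2 ^ k * a₀) ^ 2)⁻¹ ≤ t := by
    intro k
    refine le_trans ?_ hat
    have := hk1 k
    gcongr
  have h27 : 0 < Real.log (3 * (2 ^ K * a₀)) := Real.log_pos (by
    linarith [Real.add_one_le_exp (1 : ℝ), hk1 K])
  have hΛ0 : 0 < Λ := h27.trans_le hΛ
  rw [integrandNormSq, mul_assoc, mul_assoc, ENNReal.ofReal_mul (by positivity)]
  refine mul_le_mul' le_rfl ?_
  let J : ℕ → Set ℝ := fun k => Ioo (t - (9 * (2 ^ k * a₀) ^ 2)⁻¹) t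
  let w : ℕ → ℝ := fun k =>
    Real.exp (-1) * C⁻¹ * 3⁻¹ * Λ ^ (-α) * (2 ^ k * a₀) ^ 2 * ∑ j, ξ j ^ 2
  have hJ : ∀ k, J k ⊆ Ioi 0 := fun k s hs => by
    have := hs.1
    have := hinv k
    simp only [mem_Ioi]
    linarith
  calc ENNReal.ofReal (Real.exp (-1) * C⁻¹ * 27⁻¹ * (K * Λ ^ (-α) * ∑ j, ξ j ^ 2))
      = ∑ k ∈ Finset.range K, ENNReal.ofReal (w k) * volume (J k) := by
        -- The window length `(9a²)⁻¹` cancels the `a²` in `w k`, so all boxes contribute equally,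
        -- with `27 = 3 * 9`.
        have : ∀ k ∈ Finset.range K, ENNReal.ofReal (w k) * volume (J k) =
            ENNReal.ofReal (Real.exp (-1) * C⁻¹ * 27⁻¹ * (Λ ^ (-α) * ∑ j, ξ j ^ 2)) := by
          intro k _
          have : (0 : ℝ) < 2 ^ k := by positivity
          rw [Real.volume_Ioo, ← ENNReal.ofReal_mul (by positivity)]
          congr 1
          simp only [w]
          field_simp
          ring
        rw [Finset.sum_congr rfl this, Finset.sum_const, Finset.card_range, nsmul_eq_mul,
          ← ENNReal.ofReal_natCast, ← ENNReal.ofReal_mul (by positivity)]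
        congr 1
        ring
    _ = ∫⁻ s in Ioi (0 : ℝ), ∑ k ∈ Finset.range K, (J k).indicator
          (fun _ => ENNReal.ofReal (w k)) s := by
        rw [lintegral_finsetSum _ fun k _ => measurable_const.indicator measurableSet_Ioo]
        refine Finset.sum_congr rfl fun k _ => ?_
        rw [lintegral_indicator_const measurableSet_Ioo, Measure.restrict_apply measurableSet_Ioo,
          inter_eq_self_of_subset_left (hJ k)]
    _ ≤ _ := by
        -- At a fixed time, keep only the boxes whose window contains `s`; the boxes are disjoint,
        -- so their contributions add.
        refine lintegral_mono fun s => ?_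
        refine le_trans ?_ (setLIntegral_le_lintegral
          (⋃ k ∈ Finset.range K, box (2 ^ k * a₀)) _)
        rw [lintegral_biUnion_finset (pairwiseDisjoint_box ha0 _) fun k _ => measurableSet_box _]
        refine Finset.sum_le_sum fun k hk => ?_
        by_cases hs : s ∈ J k
        · rw [indicator_of_mem hs]
          have hm : (2 ^ k * a₀) * δ = 2 * Real.pi * ((2 ^ k : ℤ) : ℝ) := by
            push_cast
            linear_combination (2 : ℝ) ^ k * ha
          refine le_trans (ENNReal.ofReal_le_ofReal ?_) (energy_box hα hC hfhat ξ c hδ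
            (hae.trans (hk1 k)) _ hm (hinv k) hs)
          have hlk : 0 < Real.log (3 * (2 ^ k * a₀)) := Real.log_pos (by
            linarith [Real.add_one_le_exp (1 : ℝ), hk1 k])
          have hpow : Λ ^ (-α) ≤ Real.log (3 * (2 ^ k * a₀)) ^ (-α) := by
            refine Real.rpow_le_rpow_of_nonpos hlk (le_trans ?_ hΛ) (by linarith)
            refine Real.log_le_log (by positivity) ?_
            have := pow_le_pow_right₀ (one_le_two (α := ℝ)) (Finset.mem_range.1 hk).le
            gcongr
          simp only [w]
          gcongr
        · rw [indicator_of_notMem hs]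
          exact zero_le

/-- Nondegeneracy of the linear solution on a fine grid of length `ρ`. -/
theorem exists_energy_lower_bound {fhat : E3 → ℝ} {α C : ℝ} (hα : 0 < α) (hC : 1 < C)
    (hfhat : ∀ z : E3, Real.exp 1 ≤ ‖z‖ →
      C⁻¹ * (‖z‖ ^ (-1 : ℝ) * Real.log ‖z‖ ^ (-α)) ≤ fhat z)
    {ρ t : ℝ} (hρ : 0 < ρ) (ht : 0 < t) :
    ∃ c₀ : NNReal, 0 < c₀ ∧ ∀ᶠ K : ℕ in atTop, ∀ (c : E3) (ξ : Fin (2 ^ K) → ℝ),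
      ENNReal.ofReal ((c₀ * (K : NNReal) ^ (1 - α) : NNReal) * ∑ j, ξ j ^ 2) ≤
      integrandNormSq fhat fun q => ∑ j, ξ j * heatIntegrand t (gridPoint c (ρ / 2 ^ K) j) q := by
  have hC0 : 0 < C := by linarith
  set C₁ : ℝ := |Real.log (6 * Real.pi / ρ)| + Real.log 4 with hC₁
  have hC₁0 : 0 < C₁ := by
    have : 0 < Real.log 4 := Real.log_pos (by norm_num)
    positivity
  set c₁ : ℝ := (2 * Real.pi) ^ (-3 : ℝ) * (Real.exp (-1) * C⁻¹ * 27⁻¹) * C₁ ^ (-α) with hc₁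
  have hc₁0 : 0 < c₁ := by positivity
  refine ⟨c₁.toNNReal, Real.toNNReal_pos.2 hc₁0, ?_⟩
  have hlim : Tendsto (fun K : ℕ => (2 * Real.pi / ρ) * (2 : ℝ) ^ K) atTop atTop :=
    (tendsto_pow_atTop_atTop_of_one_lt one_lt_two).const_mul_atTop (by positivity)
  have hlim2 : Tendsto (fun K : ℕ => (9 * ((2 * Real.pi / ρ) * (2 : ℝ) ^ K) ^ 2)⁻¹) atTop (𝓝 0) :=
    tendsto_inv_atTop_zero.comp
      (((tendsto_pow_atTop two_ne_zero).comp hlim).const_mul_atTop (by norm_num))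
  filter_upwards [hlim.eventually_ge_atTop (Real.exp 1), hlim2.eventually_le_const ht,
    eventually_gt_atTop 0] with K h1 h2 h3 c ξ
  have hK : (1 : ℝ) ≤ K := by exact_mod_cast h3
  have hK0 : (0 : ℝ) < K := by linarith
  -- With `a₀ = 2π / δ = (2π / ρ) 2 ^ K`, the top frequency is of order `4 ^ K`, so its logarithm is
  -- linear in `K`; then `K (C₁ K)^(-α)` is a multiple of `K^(1-α)`.
  have hΛ : Real.log (3 * (2 ^ K * ((2 * Real.pi / ρ) * (2 : ℝ) ^ K))) ≤ C₁ * K := by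
    have : 3 * (2 ^ K * ((2 * Real.pi / ρ) * (2 : ℝ) ^ K)) = (6 * Real.pi / ρ) * 4 ^ K := by
      rw [show (4 : ℝ) = 2 * 2 by norm_num, mul_pow]
      ring
    rw [this, Real.log_mul (by positivity) (by positivity), Real.log_pow, hC₁]
    nlinarith [le_abs_self (Real.log (6 * Real.pi / ρ)), abs_nonneg (Real.log (6 * Real.pi / ρ))]
  have := energy_sum hα hC hfhat ξ c (δ := ρ / 2 ^ K) (by positivity) h1
    (by field_simp) h2 K hΛ
  refine le_trans (le_of_eq ?_) this
  congr 1
  congr 1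
  rw [Real.mul_rpow hC₁0.le hK0.le, sub_eq_add_neg]
  push_cast
  rw [Real.coe_toNNReal _ hc₁0.le, Real.rpow_add hK0, Real.rpow_one, hc₁]
  ring

/-! ### Rational grids. -/

theorem rationalPoints_eq_preimage :
    rationalPoints = (EuclideanSpace.equiv (Fin 3) ℝ) ⁻¹'
      (Set.pi univ fun _ => range ((↑) : ℚ → ℝ)) := by
  ext x
  simp [rationalPoints, eq_comm]

theorem countable_rationalPoints : rationalPoints.Countable := by
  rw [rationalPoints_eq_preimage]
  exact (Set.countable_univ_pi fun _ => countable_range _).preimage_of_injOn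
    (EuclideanSpace.equiv (Fin 3) ℝ).injective.injOn

theorem dense_rationalPoints : Dense rationalPoints := by
  rw [rationalPoints_eq_preimage]
  exact (dense_pi univ fun _ _ => Rat.denseRange_cast).preimage
    (EuclideanSpace.equiv (Fin 3) ℝ).toHomeomorph.isOpenMap

theorem gridPoint_mem_rationalPoints {c : E3} (hc : c ∈ rationalPoints) (q : ℚ) (j : ℕ) :
    gridPoint c q j ∈ rationalPoints := by
  intro i
  obtain ⟨p, hp⟩ := hc i
  by_cases hi : i = 0
  · refine ⟨p + j * q, ?_⟩
    subst hi
    simp [gridPoint, hp]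
  · refine ⟨p, ?_⟩
    simp [gridPoint, hp, hi]

theorem dist_gridPoint (c : E3) {δ : ℝ} (hδ : 0 ≤ δ) (j : ℕ) :
    dist (gridPoint c δ j) c = j * δ := by
  rw [dist_eq_norm, gridPoint, add_sub_cancel_left, norm_smul, PiLp.norm_single]
  simp [abs_of_nonneg hδ]

/-! ### Unboundedness of the solution. -/

section Solution

variable {Ω : Type*} [MeasurableSpace Ω] {P : Measure Ω} [IsProbabilityMeasure P] {α : ℝ}
  {f fhat : E3 → ℝ} {η : TestFn → Ω → ℝ} {Z : ℝ → E3 → Ω → ℝ}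

/-- The variance of the solution is bounded uniformly in space. -/
theorem exists_variance_bound (hf : IsCorrelation α f fhat) (hη : IsNoise P f η)
    (hZ : IsLinearSolution P fhat η Z) {t : ℝ} (ht : 0 ≤ t) :
    ∃ V : ℝ, ∀ x, ∫ ω, (Z t x ω - 1) ^ 2 ∂P ≤ V := by
  -- The norm of the integrand does not depend on `x`; comparing it twice with a second moment costs
  -- `2 * 2 = 4`.
  refine ⟨4 * ∫ ω, (Z t 0 ω - 1) ^ 2 ∂P, fun x => ?_⟩
  have h0 : 0 ≤ ∫ ω, (Z t 0 ω - 1) ^ 2 ∂P := integral_nonneg fun ω => sq_nonneg _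
  have h1 := ((hZ t x ht).integrandNormSq_comparable hη hf.isFourierTransform hf.hat_pos).2
  have h2 := ((hZ t 0 ht).integrandNormSq_comparable hη hf.isFourierTransform hf.hat_pos).1
  rw [integrandNormSq_heatIntegrand] at h1
  have h3 := h1.trans (mul_le_mul' (le_refl (2 : ℝ≥0∞)) h2)
  rw [← mul_assoc, show (2 : ℝ≥0∞) * 2 = ENNReal.ofReal 4 by norm_num,
    ← ENNReal.ofReal_mul (by norm_num)] at h3
  exact (ENNReal.ofReal_le_ofReal_iff (by positivity)).1 h3

/-- On any segment the solution almost surely exceeds any given level at some grid point. -/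
theorem measure_forall_grid_lt (hα₁ : 1 < α) (hα₂ : α < 2) (hf : IsCorrelation α f fhat)
    (hη : IsNoise P f η) (hZ : IsLinearSolution P fhat η Z) {t : ℝ} (ht : 0 < t) (c : E3)
    {ρ : ℝ} (hρ : 0 < ρ) (M : ℝ) :
    P {ω | ∀ K : ℕ, ∀ j : ℕ, j < 2 ^ K → Z t (gridPoint c (ρ / 2 ^ K) j) ω < M} = 0 := by
  obtain ⟨V, hV⟩ := exists_variance_bound hf hη hZ ht.le
  obtain ⟨C, hC, hfhat⟩ := hf.hat_at_infinity
  obtain ⟨c₀, hc₀, hK⟩ := exists_energy_lower_bound (by linarith : 0 < α) hC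
    (fun z hz => (hfhat z hz).1) hρ ht
  set E := {ω | ∀ K : ℕ, ∀ j : ℕ, j < 2 ^ K → Z t (gridPoint c (ρ / 2 ^ K) j) ω < M} with hE
  have hL : ∀ L : ℝ, 0 < L → P E ≤ ENNReal.ofReal (V / L ^ 2) := by
    intro L hL
    -- `c₀ / 2` absorbs the factor `2` between the second moment and the norm of the integrand; `M -
    -- 1` accounts for the mean of `Z`.
    have hlim := (tendsto_const_nhds (x := ENNReal.ofReal (V / L ^ 2))).add
      (tendsto_gaussianReal_Iio_pow α hα₁ hα₂ (c₀ / 2) (by positivity) (M - 1 + L))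
    rw [add_zero] at hlim
    refine ge_of_tendsto hlim ?_
    filter_upwards [hK] with K hK
    let X : Fin (2 ^ K) → Ω → ℝ := fun j ω => Z t (gridPoint c (ρ / 2 ^ K) j) ω - 1
    have hX : ∀ j : Fin (2 ^ K),
        IsWienerIntegral P fhat η (heatIntegrand t (gridPoint c (ρ / 2 ^ K) j)) (X j) :=
      fun j => hZ t _ ht.le
    have hsum := fun ξ : Fin (2 ^ K) → ℝ =>
      IsWienerIntegral.sum hη hf.isFourierTransform Finset.univ hX ξ
    have hsub : E ⊆ {ω | ∀ j : Fin (2 ^ K), X j ω < M - 1} := fun ω hω j => by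
      have := hω K j j.2
      simp only [X]
      linarith
    refine (measure_mono hsub).trans (measure_forall_lt_le P (by positivity) X
      (fun j => (hX j).2.2.1) (fun ξ => (hsum ξ).integral_cexp hη) _ V (fun ξ => ?_)
      (fun j => hV _) _ _ hL)
    have h1 := (hK c ξ).trans
      ((hsum ξ).integrandNormSq_comparable hη hf.isFourierTransform hf.hat_pos).1
    rw [show (2 : ℝ≥0∞) = ENNReal.ofReal 2 by norm_num, ← ENNReal.ofReal_mul (by norm_num),
      ENNReal.ofReal_le_ofReal_iff (mul_nonneg (by norm_num)
        (integral_nonneg fun ω => sq_nonneg _))] at h1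
    push_cast at h1 ⊢
    linarith
  have hlim : Tendsto (fun L : ℝ => ENNReal.ofReal (V / L ^ 2)) atTop (𝓝 0) := by
    rw [← ENNReal.ofReal_zero]
    exact ENNReal.tendsto_ofReal ((tendsto_pow_atTop two_ne_zero).const_div_atTop V)
  refine le_antisymm (ge_of_tendsto hlim ?_) zero_le
  filter_upwards [eventually_gt_atTop 0] with L h using hL L h

theorem ae_iSup_eq_top (hα₁ : 1 < α) (hα₂ : α < 2) (hf : IsCorrelation α f fhat)
    (hη : IsNoise P f η) (hZ : IsLinearSolution P fhat η Z) {t : ℝ} (ht : 0 < t) :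
    ∀ᵐ ω ∂P, ∀ (c : E3) (r : ℝ), 0 < r →
      (⨆ x ∈ Metric.ball c r ∩ rationalPoints, ((Z t x ω : ℝ) : EReal)) = ⊤ := by
  -- Rational base points, lengths `1 / (n + 1)` and integer levels form a countable family, and the
  -- dyadic spacings are rational, so the grids lie in `rationalPoints`.
  have h : ∀ᵐ ω ∂P, ∀ c ∈ rationalPoints, ∀ n M : ℕ, ∃ K j : ℕ, j < 2 ^ K ∧
      (M : ℝ) ≤ Z t (gridPoint c ((1 / (n + 1 : ℝ)) / 2 ^ K) j) ω := by
    rw [ae_ball_iff countable_rationalPoints]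
    intro c _
    rw [ae_all_iff]
    intro n
    rw [ae_all_iff]
    intro M
    have := measure_forall_grid_lt hα₁ hα₂ hf hη hZ ht c (ρ := 1 / (n + 1 : ℝ)) (by positivity) M
    rw [ae_iff]
    convert this using 4
    push Not
    rfl
  filter_upwards [h] with ω hω c r hr
  obtain ⟨c', hc'Q, hc'⟩ := dense_rationalPoints.exists_dist_lt c (half_pos hr)
  obtain ⟨n, hn⟩ := exists_nat_one_div_lt (half_pos hr)
  refine EReal.eq_top_iff_forall_lt _ |>.2 fun y => ?_
  obtain ⟨M, hM⟩ := exists_nat_gt y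
  obtain ⟨K, j, hj, hZM⟩ := hω c' hc'Q n M
  set x := gridPoint c' ((1 / (n + 1 : ℝ)) / 2 ^ K) j with hx
  have hxQ : x ∈ rationalPoints := by
    have := gridPoint_mem_rationalPoints hc'Q ((1 / (n + 1 : ℚ)) / 2 ^ K) j
    push_cast at this
    exact this
  have hxb : x ∈ Metric.ball c r := by
    rw [Metric.mem_ball]
    have h1 : dist x c' ≤ 1 / (n + 1 : ℝ) := by
      rw [hx, dist_gridPoint _ (by positivity), mul_div_assoc', div_le_iff₀ (by positivity),
        mul_comm]
      gcongr
      exact_mod_cast hj.le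
    have h2 := dist_triangle x c' c
    rw [dist_comm c' c] at h2
    linarith
  calc (y : EReal) < ((Z t x ω : ℝ) : EReal) := by exact_mod_cast hM.trans_le hZM
    _ ≤ _ := le_iSup₂ (f := fun x (_ : x ∈ Metric.ball c r ∩ rationalPoints) =>
        ((Z t x ω : ℝ) : EReal)) x ⟨hxb, hxQ⟩

end Solution

end LinearSHE

end

theorem mainTheorem7 {Ω : Type*} [MeasurableSpace Ω] (P : Measure Ω) [IsProbabilityMeasure P]
    (α : ℝ) (hα₁ : 1 < α) (hα₂ : α < 2)
    (f fhat : LinearSHE.E3 → ℝ) (hf : LinearSHE.IsCorrelation α f fhat)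
    (η : LinearSHE.TestFn → Ω → ℝ) (hη : LinearSHE.IsNoise P f η)
    (Z : ℝ → LinearSHE.E3 → Ω → ℝ) (hZ : LinearSHE.IsLinearSolution P fhat η Z)
    (t : ℝ) (ht : 0 < t) :
    (∀ᵐ ω ∂P, ∀ (c : LinearSHE.E3) (r : ℝ), 0 < r →
      (⨆ x ∈ Metric.ball c r ∩ LinearSHE.rationalPoints, ((Z t x ω : ℝ) : EReal)) = ⊤) ∧
    (∀ᵐ ω ∂P, ∀ (c : LinearSHE.E3), ∀ U ∈ 𝓝 c, ¬ BddAbove ((fun x => Z t x ω) '' U)) := by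
  have h := LinearSHE.ae_iSup_eq_top hα₁ hα₂ hf hη hZ ht
  refine ⟨h, ?_⟩
  filter_upwards [h] with ω hω c U hU hbdd
  obtain ⟨r, hr, hrU⟩ := Metric.mem_nhds_iff.1 hU
  obtain ⟨b, hb⟩ := hbdd
  have hle : (⨆ x ∈ Metric.ball c r ∩ LinearSHE.rationalPoints, ((Z t x ω : ℝ) : EReal)) ≤ b :=
    iSup₂_le fun x hx => EReal.coe_le_coe_iff.2 (hb (mem_image_of_mem _ (hrU hx.1)))
  rw [hω c r hr] at hle
  exact EReal.coe_ne_top b (top_le_iff.1 hle)
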